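/- Let $X=\{0,1\}^{\mathbb Z}$ and let $c(x,\eta)\ge 0$ be the flip rates of an attractive, translation-invariant, nearest-neighbor spin system on $\mathbb Z$: $c(x+y,\eta)=c(x,\eta(\cdot+y))$; $c(x,\eta)$ depends only on $\eta(x-1),\eta(x),\eta(x+1)$; and for $\eta\le\zeta$ one has $c(x,\eta)\le c(x,\zeta)$ if $\eta(x)=\zeta(x)=0$ and $c(x,\eta)\ge c(x,\zeta)$ if $\eta(x)=\zeta(x)=1$. Let $\varepsilon>0$ and $K$ be constants such that $c(x,\eta)\ge\varepsilon$ whenever $\eta(x-1)\ne\eta(x+1)$, and $c(x,\eta)+c(x,\zeta)\le K$ for all $x,\eta,\zeta$. The coupled process is the Feller process on the ordered triples $\eta\le\gamma\le\zeta$ in $X^3$ whose generator $\tilde\Omega$ is, on functions of finitely many sites, that of the basic (Vasershtein) coupling of three copies of the spin system: at each site, coordinates with equal values flip together at the largest possible rate, and coordinates with different values flip independently. A discrepancy is a site $x$ with $\eta(x)\ne\zeta(x)$. A discrepancy interval of length $l\ge 1$ in $[m,n]$ consists of $l$ consecutive discrepancies on which $\gamma$ is constant, such that the next discrepancy on the left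 and the next one on the right exist in $[m,n]$ and $\gamma$ takes the opposite value at both. Let $g_{m,n}^l(\eta,\gamma,\zeta)$ be the number of discrepancy intervals of length $l$ in $[m,n]$. Then for all $l\ge 1$ and $m\le n$, pointwise on the ordered triples, $$\tilde\Omega g_{m,n}^l\ \ge\ \varepsilon\,(g_{m,n}^{l+1}-2g_{m,n}^l)-4Kl\,g_{m,n}^l .$$ If $\nu$ is an invariant probability measure of the coupled process, then all $g_{m,n}^l$ are $\nu$-integrable, for all $l\ge1$ and $m\le n$ $$\varepsilon\int g_{m,n}^{l+1}\,d\nu\ \le\ (4Kl+2\varepsilon)\int g_{m,n}^l\,d\nu ,$$ and for every $l\ge 1$, $\ \sup_{m\le n}\int g_{m,n}^l\,d\nu<\infty$. -/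

import Mathlib

open scoped NNReal Topology
open Filter MeasureTheory

namespace SpinSystem

/-- Configurations `η ∈ {0,1}^ℤ`, with the product topology and the coordinatewise order
(`false` is `0`, `true` is `1`). -/
abbrev Config : Type := ℤ → Bool

/-- `c x η` is the rate at which the coordinate `η x` flips. The conditions say that `c` is the
rate function of an attractive, translation-invariant, nearest-neighbor spin system on `ℤ`. -/
structure IsAttractiveNN (c : ℤ → Config → ℝ) : Prop where
  nonneg : ∀ x η, 0 ≤ c x η
  translation : ∀ (x y : ℤ) (η : Config), c (x + y) η = c x (fun z => η (z + y))
  nearest : ∀ (x : ℤ) (η ζ : Config),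
    η (x - 1) = ζ (x - 1) → η x = ζ x → η (x + 1) = ζ (x + 1) → c x η = c x ζ
  birth_mono : ∀ (x : ℤ) (η ζ : Config), η ≤ ζ → η x = false → ζ x = false → c x η ≤ c x ζ
  death_anti : ∀ (x : ℤ) (η ζ : Config), η ≤ ζ → η x = true → ζ x = true → c x ζ ≤ c x η

/-- The possible values `(η x, γ x, ζ x)` at one site of a triple of configurations
with `η ≤ γ ≤ ζ`. -/
abbrev SiteState : Type := {s : Bool × Bool × Bool // s.1 ≤ s.2.1 ∧ s.2.1 ≤ s.2.2}

def s000 : SiteState := ⟨(false, false, false), by decide⟩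
def s001 : SiteState := ⟨(false, false, true), by decide⟩
def s011 : SiteState := ⟨(false, true, true), by decide⟩
def s111 : SiteState := ⟨(true, true, true), by decide⟩

/-- The state space of the coupled process: ordered triples `η ≤ γ ≤ ζ` of configurations,
recorded site by site. -/
abbrev Coupled : Type := ℤ → SiteState

namespace Coupled

/-- The lower configuration. -/
def eta (p : Coupled) : Config := fun x => (p x).1.1

/-- The middle configuration. -/
def gamma (p : Coupled) : Config := fun x => (p x).1.2.1

/-- The upper configuration. -/
def zeta (p : Coupled) : Config := fun x => (p x).1.2.2

end Coupled

/-- The basic (Vasershtein) coupling of three copies of the spin system started from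
`η ≤ γ ≤ ζ`: `coupledRate c x p s` is the rate at which the triple `(η x, γ x, ζ x)` jumps to `s`.
Coordinates with the same value at `x` flip together at the largest possible rate, those with
different values flip independently. Each coordinate flips at its own rate `c x _`. -/
noncomputable def coupledRate (c : ℤ → Config → ℝ) (x : ℤ) (p : Coupled) (s : SiteState) : ℝ :=
  if p x = s000 then
    if s = s111 then c x p.eta
    else if s = s011 then c x p.gamma - c x p.eta
    else if s = s001 then c x p.zeta - c x p.gamma
    else 0
  else if p x = s001 then
    if s = s111 then c x p.eta
    else if s = s011 then c x p.gamma - c x p.eta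
    else if s = s000 then c x p.zeta
    else 0
  else if p x = s011 then
    if s = s111 then c x p.eta
    else if s = s001 then c x p.gamma - c x p.zeta
    else if s = s000 then c x p.zeta
    else 0
  else
    if s = s000 then c x p.zeta
    else if s = s001 then c x p.gamma - c x p.zeta
    else if s = s011 then c x p.eta - c x p.gamma
    else 0

/-- The generator of the coupled process, to be applied to functions `f` that depend on finitely
many sites; for these only finitely many terms of the sum over `x` are nonzero. -/
noncomputable def coupledGen (c : ℤ → Config → ℝ) (f : Coupled → ℝ) (p : Coupled) : ℝ :=
  ∑ᶠ x : ℤ, ∑ s : SiteState, coupledRate c x p s * (f (Function.update p x s) - f p)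

/-- `S` is a Markov (Feller) semigroup on `C(Coupled, ℝ)`. -/
structure IsMarkovSemigroup (S : ℝ≥0 → C(Coupled, ℝ) →ₗ[ℝ] C(Coupled, ℝ)) : Prop where
  zero : ∀ f, S 0 f = f
  add : ∀ s t f, S (s + t) f = S s (S t f)
  rightCont : ∀ f t, ContinuousWithinAt (fun s => S s f) (Set.Ici t) t
  one : ∀ t, S t 1 = 1
  nonneg : ∀ t f, 0 ≤ f → 0 ≤ S t f

/-- `S` is the semigroup of the coupled process with flip rates `c`: a Markov semigroup whose
generator (a limit in the sup norm) is `coupledGen c` on functions of finitely many sites. -/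
structure IsCoupledSemigroup (c : ℤ → Config → ℝ)
    (S : ℝ≥0 → C(Coupled, ℝ) →ₗ[ℝ] C(Coupled, ℝ)) : Prop extends IsMarkovSemigroup S where
  generator : ∀ f : C(Coupled, ℝ), (∃ F : Finset ℤ, DependsOn (⇑f) (F : Set ℤ)) →
    TendstoUniformly (fun (t : ℝ≥0) p => (S t f p - f p) / (t : ℝ)) (coupledGen c f) (𝓝[>] 0)

/-- `ν` is an invariant measure of the process with semigroup `S`. -/
def IsInvariant (S : ℝ≥0 → C(Coupled, ℝ) →ₗ[ℝ] C(Coupled, ℝ)) (ν : Measure Coupled) : Prop :=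
  ∀ (t : ℝ≥0) (f : C(Coupled, ℝ)), ∫ p, S t f p ∂ν = ∫ p, f p ∂ν

/-- The discrepancy sites, where `η x ≠ ζ x`, strictly between `u` and `v`. -/
noncomputable def discBetween (p : Coupled) (u v : ℤ) : Finset ℤ :=
  (Finset.Ioo u v).filter fun x => p.eta x ≠ p.zeta x

/-- The discrepancy sites strictly between the discrepancy sites `u` and `v` form a discrepancy
interval of length `l`: there are exactly `l` of them, `γ` takes the same value at all of them and
the opposite value at `u` and at `v`. -/
def IsDiscInterval (l : ℕ) (p : Coupled) (u v : ℤ) : Prop :=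
  p.eta u ≠ p.zeta u ∧ p.eta v ≠ p.zeta v ∧ (discBetween p u v).card = l ∧
    ∀ x ∈ discBetween p u v, p.gamma x ≠ p.gamma u ∧ p.gamma x ≠ p.gamma v

open Classical in
/-- `g m n l p` is the number of discrepancy intervals of length `l` in `[m, n]`
(an interval being counted through the sites `u`, `v` next to it). -/
noncomputable def g (m n : ℤ) (l : ℕ) (p : Coupled) : ℝ :=
  (((Finset.Icc m n ×ˢ Finset.Icc m n).filter fun w => IsDiscInterval l p w.1 w.2).card : ℝ)

end SpinSystem

namespace SpinSystem

/-! Color each discrepancy by the value of `γ` there. Discrepancy intervals become blocks of equally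
colored sites bounded by two sites of the other color, and the question is what a jump at one site
does to a sequence with values in {none, 0, 1}. Two facts about the rates are needed. A color can
appear at a site only if a neighbor already carries it (`neighbor_colored_of_coupledRate_ne_zero`),
by nearest-neighbor dependence. A colored site next to a site that is uncolored or of the other
color jumps at rate at least `ε` (`le_sum_coupledRate`), by attractiveness.

Hence the leftmost site of a block of length `l + 1` leaves it at rate at least `ε`, and a block of
length `l` remains. A block of length `l` is lost only through a jump at one of its `l` sites or two
bounding sites, each of rate at most `K`, or through a color entering an uncolored site adjacent to
one of its sites, at most `2l` places of rate at most `K / 2`. The loss rate per block is at most `K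
(l + 2) + K l = K (2l + 2) ≤ 4 K l`.

Integrating against an invariant measure kills the generator term and leaves a recursion in `l`. It
starts from the number of color changes in `[m, n]`. Inside the window this number cannot increase,
because colors spread only from neighbors; a jump at an end site adds at most one, at rate at most
`K`; every block of length one contributes a decrease at rate at least `ε`. So `ε ∫ g¹ ≤ 2 K`,
uniformly in the window (`coupledGen_switches_le`). -/

/-- The sites in `(u, v)` which carry a color. -/
noncomputable def coloredBetween (d : ℤ → Option Bool) (u v : ℤ) : Finset ℤ :=
  (Finset.Ioo u v).filter fun x => d x ≠ none

/-- `u` and `v` bound a monochromatic block of `l` colored sites, of the opposite color. -/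
def IsRun (l : ℕ) (d : ℤ → Option Bool) (u v : ℤ) : Prop :=
  d u ≠ none ∧ d v ≠ none ∧ (coloredBetween d u v).card = l ∧
    ∀ x ∈ coloredBetween d u v, d x ≠ d u ∧ d x ≠ d v

open Classical in
/-- The blocks of length `l` whose bounding sites lie in `[m, n]`. -/
noncomputable def runs (m n : ℤ) (l : ℕ) (d : ℤ → Option Bool) : Finset (ℤ × ℤ) :=
  (Finset.Icc m n ×ˢ Finset.Icc m n).filter fun w => IsRun l d w.1 w.2

/-- `u < v` are consecutive colored sites of different colors. -/
def IsSwitch (d : ℤ → Option Bool) (u v : ℤ) : Prop :=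
  u < v ∧ d u ≠ none ∧ d v ≠ none ∧ d u ≠ d v ∧ ∀ x, u < x → x < v → d x = none

open Classical in
/-- The color changes in `[m, n]`. -/
noncomputable def switches (m n : ℤ) (d : ℤ → Option Bool) : Finset (ℤ × ℤ) :=
  (Finset.Icc m n ×ˢ Finset.Icc m n).filter fun w => IsSwitch d w.1 w.2

theorem mem_coloredBetween {d : ℤ → Option Bool} {u v x : ℤ} :
    x ∈ coloredBetween d u v ↔ (u < x ∧ x < v) ∧ d x ≠ none := by
  simp [coloredBetween]

theorem mem_runs {m n : ℤ} {l : ℕ} {d : ℤ → Option Bool} {w : ℤ × ℤ} :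
    w ∈ runs m n l d ↔
      ((m ≤ w.1 ∧ w.1 ≤ n) ∧ (m ≤ w.2 ∧ w.2 ≤ n)) ∧ IsRun l d w.1 w.2 := by
  simp [runs]

theorem mem_switches {m n : ℤ} {d : ℤ → Option Bool} {w : ℤ × ℤ} :
    w ∈ switches m n d ↔
      ((m ≤ w.1 ∧ w.1 ≤ n) ∧ (m ≤ w.2 ∧ w.2 ≤ n)) ∧ IsSwitch d w.1 w.2 := by
  simp [switches]

/-! ### Blocks under a change of color at one site. -/

theorem IsRun.lt {l : ℕ} {d : ℤ → Option Bool} {u v : ℤ} (h : IsRun l d u v) (hl : 1 ≤ l) :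
    u < v := by
  have h1 : (coloredBetween d u v).Nonempty := by
    rw [← Finset.card_pos, h.2.2.1]; omega
  obtain ⟨x, hx⟩ := h1
  have := mem_coloredBetween.1 hx
  omega

/-- Moving one bound outwards past a colored site strictly increases the number of enclosed colored
sites. -/
theorem IsRun.left_unique {l : ℕ} {d : ℤ → Option Bool} {u u' v : ℤ} (hl : 1 ≤ l)
    (h : IsRun l d u v) (h' : IsRun l d u' v) : u = u' := by
  have key : ∀ a b : ℤ, IsRun l d a v → IsRun l d b v → ¬ a < b := by
    intro a b ha hb hab
    have hbv := hb.lt hl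
    have hs : coloredBetween d b v ⊂ coloredBetween d a v := by
      refine Finset.ssubset_iff_of_subset ?_ |>.2 ⟨b, ?_, ?_⟩
      · intro x hx
        rw [mem_coloredBetween] at hx ⊢
        exact ⟨by omega, hx.2⟩
      · exact mem_coloredBetween.2 ⟨by omega, hb.1⟩
      · simp [mem_coloredBetween]
    have := Finset.card_lt_card hs
    rw [ha.2.2.1, hb.2.2.1] at this
    omega
  have h1 := key _ _ h h'
  have h2 := key _ _ h' h
  omega

theorem IsRun.congr {l : ℕ} {d d' : ℤ → Option Bool} {u v : ℤ} (h : IsRun l d u v)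
    (hd : ∀ x, u ≤ x → x ≤ v → d' x = d x) (huv : u < v) : IsRun l d' u v := by
  have hu := hd u le_rfl huv.le
  have hv := hd v huv.le le_rfl
  have hb : coloredBetween d' u v = coloredBetween d u v := by
    ext x
    simp only [mem_coloredBetween]
    constructor
    · rintro ⟨h1, h2⟩
      rw [hd x h1.1.le h1.2.le] at h2
      exact ⟨h1, h2⟩
    · rintro ⟨h1, h2⟩
      rw [← hd x h1.1.le h1.2.le] at h2
      exact ⟨h1, h2⟩
  refine ⟨hu ▸ h.1, hv ▸ h.2.1, hb ▸ h.2.2.1, ?_⟩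
  intro x hx
  rw [hb] at hx
  have hx' := mem_coloredBetween.1 hx
  rw [hu, hv, hd x hx'.1.1.le hx'.1.2.le]
  exact h.2.2.2 x hx

open Classical in
-- If `x - 1` is the left bound of a block, `x` takes over that role. Blocks with `x - 1` neither
-- inside nor as left bound avoid `x` altogether. So only blocks with `x - 1` inside can be lost.
theorem card_runs_le_insert_left {m n : ℤ} {l : ℕ} (hl : 1 ≤ l) {d : ℤ → Option Bool} {x : ℤ}
    {k : Bool} (hx : d x = none) (hy : d (x - 1) = some k) (hxn : x ≤ n) :
    (runs m n l d).card ≤ (runs m n l (Function.update d x (some k))).card +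
      ((runs m n l d).filter fun w => x - 1 ∈ coloredBetween d w.1 w.2).card := by
  rw [← Finset.card_filter_add_card_filter_not (s := runs m n l d)
    (fun w => x - 1 ∈ coloredBetween d w.1 w.2), add_comm]
  refine Nat.add_le_add_right ?_ _
  refine Finset.card_le_card_of_injOn
    (fun w => (if w.1 = x - 1 then x else w.1, w.2)) ?_ ?_
  · rintro ⟨u, v⟩ hw
    simp only [Finset.coe_filter, Set.mem_ofPred_eq, mem_runs] at hw
    obtain ⟨⟨⟨hu, hv⟩, hr⟩, hn⟩ := hw
    have huv := hr.lt hl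
    simp only [Finset.mem_coe, mem_runs]
    have hux : u ≠ x := fun h => hr.1 (h ▸ hx)
    have hvx : v ≠ x := fun h => hr.2.1 (h ▸ hx)
    rw [mem_coloredBetween] at hn
    have hn' : ¬ (u < x - 1 ∧ x - 1 < v) := fun h => hn ⟨h, by simp [hy]⟩
    split_ifs with h
    · subst h
      refine ⟨by omega, ?_⟩
      have hb : coloredBetween (Function.update d x (some k)) x v = coloredBetween d (x - 1) v := by
        ext z
        simp only [mem_coloredBetween]
        constructor
        · rintro ⟨h1, h2⟩
          rw [Function.update_of_ne (by omega)] at h2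
          exact ⟨by omega, h2⟩
        · rintro ⟨h1, h2⟩
          have hz : z ≠ x := fun h => h2 (h ▸ hx)
          rw [Function.update_of_ne hz]
          exact ⟨by omega, h2⟩
      have hvv : Function.update d x (some k) v = d v := Function.update_of_ne hvx _ _
      refine ⟨by simp, by rw [hvv]; exact hr.2.1, by rw [hb]; exact hr.2.2.1, ?_⟩
      intro z hz
      rw [hb] at hz
      have hz' := hr.2.2.2 z hz
      have hzx : z ≠ x := fun h => (mem_coloredBetween.1 hz).2 (h ▸ hx)
      rw [hvv, Function.update_of_ne hzx, Function.update_self, ← hy]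
      exact hz'
    · refine ⟨by omega, hr.congr (fun z h1 h2 => Function.update_of_ne (by omega) _ _) huv⟩
  · rintro ⟨u, v⟩ hw ⟨u', v'⟩ hw' he
    simp only [Finset.coe_filter, Set.mem_ofPred_eq, mem_runs] at hw hw'
    have hux : u ≠ x := fun h => hw.1.2.1 (h ▸ hx)
    have hux' : u' ≠ x := fun h => hw'.1.2.1 (h ▸ hx)
    simp only [Prod.mk.injEq] at he ⊢
    refine ⟨?_, he.2⟩
    have := he.1
    split_ifs at this <;> omega

open Classical in
theorem card_runs_le_insert_right {m n : ℤ} {l : ℕ} (hl : 1 ≤ l) {d : ℤ → Option Bool} {x : ℤ}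
    {k : Bool} (hx : d x = none) (hy : d (x + 1) = some k) (hmx : m ≤ x) :
    (runs m n l d).card ≤ (runs m n l (Function.update d x (some k))).card +
      ((runs m n l d).filter fun w => x + 1 ∈ coloredBetween d w.1 w.2).card := by
  rw [← Finset.card_filter_add_card_filter_not (s := runs m n l d)
    (fun w => x + 1 ∈ coloredBetween d w.1 w.2), add_comm]
  refine Nat.add_le_add_right ?_ _
  refine Finset.card_le_card_of_injOn
    (fun w => (w.1, if w.2 = x + 1 then x else w.2)) ?_ ?_
  · rintro ⟨u, v⟩ hw
    simp only [Finset.coe_filter, Set.mem_ofPred_eq, mem_runs] at hw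
    obtain ⟨⟨⟨hu, hv⟩, hr⟩, hn⟩ := hw
    have huv := hr.lt hl
    simp only [Finset.mem_coe, mem_runs]
    have hux : u ≠ x := fun h => hr.1 (h ▸ hx)
    have hvx : v ≠ x := fun h => hr.2.1 (h ▸ hx)
    rw [mem_coloredBetween] at hn
    have hn' : ¬ (u < x + 1 ∧ x + 1 < v) := fun h => hn ⟨h, by simp [hy]⟩
    split_ifs with h
    · subst h
      refine ⟨by omega, ?_⟩
      have hb : coloredBetween (Function.update d x (some k)) u x = coloredBetween d u (x + 1) := by
        ext z
        simp only [mem_coloredBetween]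
        constructor
        · rintro ⟨h1, h2⟩
          rw [Function.update_of_ne (by omega)] at h2
          exact ⟨by omega, h2⟩
        · rintro ⟨h1, h2⟩
          have hz : z ≠ x := fun h => h2 (h ▸ hx)
          rw [Function.update_of_ne hz]
          exact ⟨by omega, h2⟩
      have hvv : Function.update d x (some k) u = d u := Function.update_of_ne hux _ _
      refine ⟨by rw [hvv]; exact hr.1, by simp, by rw [hb]; exact hr.2.2.1, ?_⟩
      intro z hz
      rw [hb] at hz
      have hz' := hr.2.2.2 z hz
      have hzx : z ≠ x := fun h => (mem_coloredBetween.1 hz).2 (h ▸ hx)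
      rw [hvv, Function.update_of_ne hzx, Function.update_self, ← hy]
      exact hz'
    · refine ⟨by omega, hr.congr (fun z h1 h2 => Function.update_of_ne (by omega) _ _) huv⟩
  · rintro ⟨u, v⟩ hw ⟨u', v'⟩ hw' he
    simp only [Finset.coe_filter, Set.mem_ofPred_eq, mem_runs] at hw hw'
    have hvx : v ≠ x := fun h => hw.1.2.2.1 (h ▸ hx)
    have hvx' : v' ≠ x := fun h => hw'.1.2.2.1 (h ▸ hx)
    simp only [Prod.mk.injEq] at he ⊢
    refine ⟨he.1, ?_⟩
    have := he.2
    split_ifs at this <;> omega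

/-- Two colors different from a third one are equal. -/
theorem color_eq_of_ne {a b k : Option Bool} (ha : a ≠ none) (hb : b ≠ none) (hk : k ≠ none)
    (h : a ≠ k) (h' : b ≠ k) : a = b := by
  revert a b k
  decide

open Classical in
-- Blocks that do not touch `x` survive, and each block of length `l + 1` with leftmost site `x`
-- yields a new block of length `l`.
theorem card_runs_add_le_exit {m n : ℤ} {l : ℕ} (hl : 1 ≤ l) {d : ℤ → Option Bool} {x : ℤ}
    {o : Option Bool} (hx : d x ≠ none) (ho : o ≠ d x) :
    (runs m n l d).card +
        ((runs m n (l + 1) d).filter fun w => x ∈ coloredBetween d w.1 w.2 ∧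
          ∀ z ∈ coloredBetween d w.1 w.2, x ≤ z).card ≤
      (runs m n l (Function.update d x o)).card +
        ((runs m n l d).filter fun w => w.1 = x ∨ w.2 = x ∨ x ∈ coloredBetween d w.1 w.2).card := by
  rw [← Finset.card_filter_add_card_filter_not (s := runs m n l d)
    (fun w => w.1 = x ∨ w.2 = x ∨ x ∈ coloredBetween d w.1 w.2)]
  set A := (runs m n l d).filter
    fun w => ¬ (w.1 = x ∨ w.2 = x ∨ x ∈ coloredBetween d w.1 w.2) with hA
  set B := (runs m n (l + 1) d).filter fun w => x ∈ coloredBetween d w.1 w.2 ∧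
          ∀ z ∈ coloredBetween d w.1 w.2, x ≤ z with hB
  suffices h : A.card + B.card ≤ (runs m n l (Function.update d x o)).card by omega
  -- The shortened block keeps its left bound if `x` is erased. If `x` is recolored it takes the
  -- color of that bound, as there are only two colors, and becomes the new bound.
  set φ : ℤ × ℤ → ℤ × ℤ := fun w => (if o = none then w.1 else x, w.2) with hφ
  have hinj : Set.InjOn φ B := by
    rintro ⟨u, v⟩ hw ⟨u', v'⟩ hw' he
    simp only [hB, Finset.coe_filter, Set.mem_ofPred_eq, mem_runs] at hw hw'
    have h2 : v = v' := (Prod.mk.inj he).2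
    subst h2
    rw [hw.1.2.left_unique (by omega) hw'.1.2]
  rw [← Finset.card_image_of_injOn hinj, ← Finset.card_union_of_disjoint]
  · refine Finset.card_le_card ?_
    intro w hw
    rw [Finset.mem_union] at hw
    rcases hw with hw | hw
    · simp only [hA, Finset.mem_filter, mem_runs, mem_coloredBetween, not_or] at hw
      obtain ⟨⟨h1, hr⟩, h2, h3, h4⟩ := hw
      rw [mem_runs]
      refine ⟨h1, hr.congr (fun z hz1 hz2 => Function.update_of_ne ?_ _ _) (hr.lt hl)⟩
      rintro rfl
      exact h4 ⟨⟨by omega, by omega⟩, hx⟩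
    · rw [Finset.mem_image] at hw
      obtain ⟨⟨u, v⟩, hw, rfl⟩ := hw
      simp only [hB, Finset.mem_filter, mem_runs] at hw
      obtain ⟨⟨h1, hr⟩, h2, h3⟩ := hw
      have hxb := mem_coloredBetween.1 h2
      have hvx : v ≠ x := by omega
      have hux : u ≠ x := by omega
      have hb : coloredBetween (Function.update d x o) (φ (u, v)).1 (φ (u, v)).2 =
          (coloredBetween d u v).erase x := by
        ext z
        simp only [hφ, Finset.mem_erase, mem_coloredBetween]
        constructor
        · rintro ⟨h4, h5⟩
          have hzx : z ≠ x := by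
            rintro rfl
            rw [Function.update_self] at h5
            rw [if_neg h5] at h4
            omega
          rw [Function.update_of_ne hzx] at h5
          refine ⟨hzx, ?_, h5⟩
          split_ifs at h4 <;> omega
        · rintro ⟨hzx, h4, h5⟩
          have := h3 z (mem_coloredBetween.2 ⟨h4, h5⟩)
          rw [Function.update_of_ne hzx]
          refine ⟨?_, h5⟩
          split_ifs <;> omega
      have hvv : Function.update d x o v = d v := Function.update_of_ne hvx _ _
      have huu : Function.update d x o (φ (u, v)).1 = d u := by
        simp only [hφ]
        split_ifs with h
        · exact Function.update_of_ne hux _ _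
        · rw [Function.update_self]
          exact color_eq_of_ne h hr.1 hx ho (hr.2.2.2 x h2).1.symm
      rw [mem_runs]
      refine ⟨⟨?_, h1.2⟩, ?_⟩
      · simp only [hφ]
        split_ifs
        · exact h1.1
        · omega
      · refine ⟨huu ▸ hr.1, hvv ▸ hr.2.1, ?_, ?_⟩
        · rw [hb, Finset.card_erase_of_mem h2, hr.2.2.1]
          omega
        · intro z hz
          rw [hb, Finset.mem_erase] at hz
          rw [huu, Function.update_of_ne hz.1]
          change _ ∧ _ ≠ Function.update d x o v
          rw [hvv]
          exact hr.2.2.2 z hz.2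
  · rw [Finset.disjoint_left]
    rintro w hw hw'
    rw [Finset.mem_image] at hw'
    obtain ⟨⟨u, v⟩, hw', rfl⟩ := hw'
    simp only [hB, Finset.mem_filter, mem_runs] at hw'
    simp only [hA, hφ, Finset.mem_filter, mem_runs] at hw
    -- With `x` erased, the same pair would bound blocks of lengths `l` and `l + 1`; with `x`
    -- recolored, the pair starts at `x`, which `A` excludes.
    split_ifs at hw with h
    · have h1 := hw.1.2.2.2.1
      have h2 := hw'.1.2.2.2.1
      omega
    · exact hw.2 (Or.inl rfl)

theorem IsRun.right_unique {l : ℕ} {d : ℤ → Option Bool} {u v v' : ℤ} (hl : 1 ≤ l)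
    (h : IsRun l d u v) (h' : IsRun l d u v') : v = v' := by
  have key : ∀ a b : ℤ, IsRun l d u a → IsRun l d u b → ¬ a < b := by
    intro a b ha hb hab
    have hua := ha.lt hl
    have hs : coloredBetween d u a ⊂ coloredBetween d u b := by
      refine Finset.ssubset_iff_of_subset ?_ |>.2 ⟨a, ?_, ?_⟩
      · intro x hx
        rw [mem_coloredBetween] at hx ⊢
        exact ⟨by omega, hx.2⟩
      · exact mem_coloredBetween.2 ⟨by omega, ha.2.1⟩
      · simp [mem_coloredBetween]
    have := Finset.card_lt_card hs
    rw [ha.2.2.1, hb.2.2.1] at this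
    omega
  have h1 := key _ _ h h'
  have h2 := key _ _ h' h
  omega

/-! ### Color changes, and the effect on them of a jump at one site. -/

theorem IsRun.eq_none_of_one {d : ℤ → Option Bool} {u v x z : ℤ} (h : IsRun 1 d u v)
    (hx : x ∈ coloredBetween d u v) (huz : u < z) (hzv : z < v) (hzx : z ≠ x) : d z = none := by
  by_contra hz
  exact hzx (Finset.card_le_one.1 h.2.2.1.le z (mem_coloredBetween.2 ⟨⟨huz, hzv⟩, hz⟩) x hx)

theorem IsRun.switch_left {d : ℤ → Option Bool} {u v x : ℤ} (h : IsRun 1 d u v)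
    (hx : x ∈ coloredBetween d u v) : IsSwitch d u x := by
  have hx' := mem_coloredBetween.1 hx
  exact ⟨hx'.1.1, h.1, hx'.2, (h.2.2.2 x hx).1.symm,
    fun z h1 h2 => h.eq_none_of_one hx h1 (by omega) (by omega)⟩

theorem IsRun.switch_right {d : ℤ → Option Bool} {u v x : ℤ} (h : IsRun 1 d u v)
    (hx : x ∈ coloredBetween d u v) : IsSwitch d x v := by
  have hx' := mem_coloredBetween.1 hx
  exact ⟨hx'.1.2, hx'.2, h.2.1, (h.2.2.2 x hx).2,
    fun z h1 h2 => h.eq_none_of_one hx (by omega) h2 (by omega)⟩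

theorem IsSwitch.congr {d d' : ℤ → Option Bool} {u v : ℤ} (h : IsSwitch d u v)
    (hd : ∀ x, u ≤ x → x ≤ v → d' x = d x) : IsSwitch d' u v := by
  obtain ⟨h1, h2, h3, h4, h5⟩ := h
  refine ⟨h1, ?_, ?_, ?_, fun x hx hx' => ?_⟩
  · rwa [hd u le_rfl h1.le]
  · rwa [hd v h1.le le_rfl]
  · rwa [hd u le_rfl h1.le, hd v h1.le le_rfl]
  · rw [hd x hx.le hx'.le]; exact h5 x hx hx'

theorem IsSwitch.right_unique {d : ℤ → Option Bool} {u v v' : ℤ} (h : IsSwitch d u v)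
    (h' : IsSwitch d u v') : v = v' := by
  have h1 := h.2.2.2.2 v' h'.1
  have h2 := h'.2.2.2.2 v h.1
  have h3 := h.2.2.1
  have h4 := h'.2.2.1
  grind

theorem IsSwitch.left_unique {d : ℤ → Option Bool} {u u' v : ℤ} (h : IsSwitch d u v)
    (h' : IsSwitch d u' v) : u = u' := by
  have h1 := fun a => h.2.2.2.2 u' a h'.1
  have h2 := fun a => h'.2.2.2.2 u a h.1
  have h3 := h.2.1
  have h4 := h'.2.1
  grind

/-- After the insertion no change ends at `x`, and a change starting at `x` started at `x - 1`
before; `m < x` keeps `x - 1` in the window. -/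
theorem card_switches_insert_left_le {m n : ℤ} {d : ℤ → Option Bool} {x : ℤ} {k : Bool}
    (hx : d x = none) (hy : d (x - 1) = some k) (hmx : m < x) :
    (switches m n (Function.update d x (some k))).card ≤ (switches m n d).card := by
  have hd : ∀ z, z ≠ x → Function.update d x (some k) z = d z :=
    fun z hz => Function.update_of_ne hz _ _
  have hdx : Function.update d x (some k) x = some k := Function.update_self ..
  set d' := Function.update d x (some k)
  have hy' : d' (x - 1) = some k := by rw [hd _ (by omega), hy]
  have hv : ∀ u, ¬ IsSwitch d' u x := by
    rintro u ⟨h1, -, -, h4, h5⟩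
    rcases eq_or_ne u (x - 1) with rfl | h
    · exact h4 (hy'.trans hdx.symm)
    · have := h5 (x - 1) (by omega) (by omega)
      simp [hy'] at this
  have hu : ∀ v, ¬ IsSwitch d' (x - 1) v := by
    intro v h
    have h1 := h.1
    rcases eq_or_ne v x with rfl | h2
    · exact hv _ h
    · have := h.2.2.2.2 x (by omega) (by omega)
      simp [hdx] at this
  refine Finset.card_le_card_of_injOn (fun w => (if w.1 = x then x - 1 else w.1, w.2)) ?_ ?_
  · rintro ⟨u, v⟩ hw
    simp only [Finset.mem_coe, mem_switches] at hw ⊢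
    obtain ⟨h1, hs⟩ := hw
    have hvx : v ≠ x := by rintro rfl; exact hv _ hs
    obtain ⟨h3, h4, h5, h6, h7⟩ := hs
    split_ifs with h
    · subst h
      refine ⟨by omega, by omega, by simp [hy], by rwa [← hd v hvx], ?_, ?_⟩
      · rwa [hy, ← hdx, ← hd v hvx]
      · intro z hz hz'
        rcases eq_or_ne z u with rfl | hzu
        · exact hx
        · rw [← hd z hzu]; exact h7 z (by omega) hz'
    · refine ⟨h1, h3, by rwa [← hd u h], by rwa [← hd v hvx], by rwa [← hd u h, ← hd v hvx], ?_⟩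
      intro z hz hz'
      rcases eq_or_ne z x with rfl | hzu
      · exact hx
      · rw [← hd z hzu]; exact h7 z (by omega) hz'
  · rintro ⟨u, v⟩ hw ⟨u', v'⟩ hw' he
    simp only [Finset.mem_coe, mem_switches] at hw hw'
    simp only [Prod.mk.injEq] at he ⊢
    obtain ⟨he, rfl⟩ := he
    exact ⟨hw.2.left_unique hw'.2, rfl⟩

theorem card_switches_insert_right_le {m n : ℤ} {d : ℤ → Option Bool} {x : ℤ} {k : Bool}
    (hx : d x = none) (hy : d (x + 1) = some k) (hxn : x < n) :
    (switches m n (Function.update d x (some k))).card ≤ (switches m n d).card := by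
  have hd : ∀ z, z ≠ x → Function.update d x (some k) z = d z :=
    fun z hz => Function.update_of_ne hz _ _
  have hdx : Function.update d x (some k) x = some k := Function.update_self ..
  set d' := Function.update d x (some k)
  have hy' : d' (x + 1) = some k := by rw [hd _ (by omega), hy]
  have hu : ∀ v, ¬ IsSwitch d' x v := by
    rintro v ⟨h1, -, -, h4, h5⟩
    rcases eq_or_ne v (x + 1) with rfl | h
    · exact h4 (hdx.trans hy'.symm)
    · have := h5 (x + 1) (by omega) (by omega)
      simp [hy'] at this
  refine Finset.card_le_card_of_injOn (fun w => (w.1, if w.2 = x then x + 1 else w.2)) ?_ ?_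
  · rintro ⟨u, v⟩ hw
    simp only [Finset.mem_coe, mem_switches] at hw ⊢
    obtain ⟨h1, hs⟩ := hw
    have hux : u ≠ x := by rintro rfl; exact hu _ hs
    obtain ⟨h3, h4, h5, h6, h7⟩ := hs
    split_ifs with h
    · subst h
      refine ⟨by omega, by omega, by rwa [← hd u hux], by simp [hy], ?_, ?_⟩
      · rwa [hy, ← hdx, ← hd u hux]
      · intro z hz hz'
        rcases eq_or_ne z v with rfl | hzu
        · exact hx
        · rw [← hd z hzu]; exact h7 z hz (by omega)
    · refine ⟨h1, h3, by rwa [← hd u hux], by rwa [← hd v h], by rwa [← hd u hux, ← hd v h], ?_⟩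
      intro z hz hz'
      rcases eq_or_ne z x with rfl | hzu
      · exact hx
      · rw [← hd z hzu]; exact h7 z (by omega) hz'
  · rintro ⟨u, v⟩ hw ⟨u', v'⟩ hw' he
    simp only [Finset.mem_coe, mem_switches] at hw hw'
    simp only [Prod.mk.injEq] at he ⊢
    obtain ⟨rfl, he⟩ := he
    exact ⟨rfl, hw.2.right_unique hw'.2⟩

open Classical in
-- A block consisting of `x` alone, with right bound `v`, gives the old color change `(x, v)`. An
-- injection of the new changes into the old ones that misses these pairs shows that the jump costs
-- one change per such block.
theorem card_switches_add_le_of_injOn {m n : ℤ} {d d' : ℤ → Option Bool} {x : ℤ}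
    (φ : ℤ × ℤ → ℤ × ℤ) (hφ : Set.InjOn φ (switches m n d'))
    (hm : ∀ w ∈ switches m n d', φ w ∈ switches m n d)
    (hr : ∀ w ∈ switches m n d', ∀ u v, IsRun 1 d u v → x ∈ coloredBetween d u v →
      φ w ≠ (x, v)) :
    (switches m n d').card +
      ((runs m n 1 d).filter fun w => x ∈ coloredBetween d w.1 w.2).card ≤
      (switches m n d).card := by
  set R := (runs m n 1 d).filter fun w => x ∈ coloredBetween d w.1 w.2 with hR
  have hinj : Set.InjOn (fun w : ℤ × ℤ => (x, w.2)) R := by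
    rintro ⟨u, v⟩ hw ⟨u', v'⟩ hw' he
    simp only [hR, Finset.coe_filter, Set.mem_ofPred_eq, mem_runs] at hw hw'
    obtain rfl : v = v' := (Prod.mk.inj he).2
    rw [hw.1.2.left_unique le_rfl hw'.1.2]
  rw [← Finset.card_image_of_injOn hinj, ← Finset.card_image_of_injOn hφ,
    ← Finset.card_union_of_disjoint]
  · refine Finset.card_le_card (Finset.union_subset ?_ ?_)
    · intro w hw
      obtain ⟨w', hw', rfl⟩ := Finset.mem_image.1 hw
      exact hm w' hw'
    · intro w hw
      obtain ⟨⟨u, v⟩, hw', rfl⟩ := Finset.mem_image.1 hw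
      simp only [hR, Finset.mem_filter, mem_runs] at hw'
      obtain ⟨⟨h1, h2⟩, h3⟩ := hw'
      have h4 := mem_coloredBetween.1 h3
      rw [mem_switches]
      refine ⟨?_, h2.switch_right h3⟩
      simp only
      omega
  · rw [Finset.disjoint_left]
    intro w hw hw'
    obtain ⟨w1, hw1, rfl⟩ := Finset.mem_image.1 hw
    obtain ⟨⟨u, v⟩, hw2, he⟩ := Finset.mem_image.1 hw'
    simp only [hR, Finset.mem_filter, mem_runs] at hw2
    exact hr w1 hw1 u v hw2.1.2 hw2.2 he.symm

open Classical in
-- Once `x` agrees with `x - 1`, no change ends at `x`. A change starting at `x` is charged to `(x -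
-- 1, x)`, which the flip destroys, so no image starts at `x`.
theorem card_switches_flip_left_add_le {m n : ℤ} {d : ℤ → Option Bool} {x : ℤ} {k : Bool}
    (hx : d x ≠ none) (hxk : d x ≠ some k) (hy : d (x - 1) = some k) (hmx : m < x)
    (hxn : x ≤ n) :
    (switches m n (Function.update d x (some k))).card +
      ((runs m n 1 d).filter fun w => x ∈ coloredBetween d w.1 w.2).card ≤
      (switches m n d).card := by
  have hd : ∀ z, z ≠ x → Function.update d x (some k) z = d z :=
    fun z hz => Function.update_of_ne hz _ _
  have hdx : Function.update d x (some k) x = some k := Function.update_self ..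
  set d' := Function.update d x (some k)
  have hy' : d' (x - 1) = some k := by rw [hd _ (by omega), hy]
  have hv : ∀ u, ¬ IsSwitch d' u x := by
    rintro u ⟨h1, -, -, h4, h5⟩
    rcases eq_or_ne u (x - 1) with rfl | h
    · exact h4 (hy'.trans hdx.symm)
    · have := h5 (x - 1) (by omega) (by omega)
      simp [hy'] at this
  have hu : ∀ v, ¬ IsSwitch d' (x - 1) v := by
    intro v h
    have h1 := h.1
    rcases eq_or_ne v x with rfl | h2
    · exact hv _ h
    · have := h.2.2.2.2 x (by omega) (by omega)
      simp [hdx] at this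
  refine card_switches_add_le_of_injOn (fun w => if w.1 = x then (x - 1, x) else w) ?_ ?_ ?_
  · rintro ⟨u, v⟩ hw ⟨u', v'⟩ hw' he
    simp only [Finset.mem_coe, mem_switches] at hw hw'
    simp only at he
    split_ifs at he with h1 h2 h2
    · subst h1; subst h2
      rw [hw.2.right_unique hw'.2]
    · rw [← (Prod.mk.inj he).1] at hw'
      exact absurd hw'.2 (hu _)
    · rw [(Prod.mk.inj he).1] at hw
      exact absurd hw.2 (hu _)
    · exact he
  · rintro ⟨u, v⟩ hw
    simp only [mem_switches] at hw ⊢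
    obtain ⟨h1, hs⟩ := hw
    have hvx : v ≠ x := by rintro rfl; exact hv _ hs
    split_ifs with h
    · exact ⟨by simp only; omega, by simp only; omega, by simp [hy], hx,
        by simp only; rw [hy]; exact hxk.symm, fun z h1 h2 => by simp only at h1 h2; omega⟩
    · refine ⟨h1, hs.congr fun z hz hz' => (hd z ?_).symm⟩
      rintro rfl
      have := hs.2.2.2.2 z (by omega) (by omega)
      simp [hdx] at this
  · rintro ⟨u, v⟩ hw u0 v0 hr hb he
    simp only at he
    split_ifs at he with h
    · have := (Prod.mk.inj he).1
      omega
    · exact h (Prod.mk.inj he).1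

open Classical in
-- Here a new change ending at `x` is charged to `(x, x + 1)`, the very pair to be missed when `x`
-- alone is a block, so that case needs an argument.
theorem card_switches_flip_right_add_le {m n : ℤ} {d : ℤ → Option Bool} {x : ℤ} {k : Bool}
    (hx : d x ≠ none) (hxk : d x ≠ some k) (hy : d (x + 1) = some k) (hmx : m ≤ x)
    (hxn : x < n) :
    (switches m n (Function.update d x (some k))).card +
      ((runs m n 1 d).filter fun w => x ∈ coloredBetween d w.1 w.2).card ≤
      (switches m n d).card := by
  have hd : ∀ z, z ≠ x → Function.update d x (some k) z = d z :=
    fun z hz => Function.update_of_ne hz _ _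
  have hdx : Function.update d x (some k) x = some k := Function.update_self ..
  set d' := Function.update d x (some k)
  have hy' : d' (x + 1) = some k := by rw [hd _ (by omega), hy]
  have hu : ∀ v, ¬ IsSwitch d' x v := by
    rintro v ⟨h1, -, -, h4, h5⟩
    rcases eq_or_ne v (x + 1) with rfl | h
    · exact h4 (hdx.trans hy'.symm)
    · have := h5 (x + 1) (by omega) (by omega)
      simp [hy'] at this
  have hv : ∀ u, ¬ IsSwitch d' u (x + 1) := by
    intro u h
    have h1 := h.1
    rcases eq_or_ne u x with rfl | h2
    · exact hu _ h
    · have := h.2.2.2.2 x (by omega) (by omega)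
      simp [hdx] at this
  have hk : ∀ u v, IsRun 1 d u v → x ∈ coloredBetween d u v → v = x + 1 := by
    intro u v hr hb
    have hs := hr.switch_right hb
    by_contra h
    have h1 := hs.1
    have := hs.2.2.2.2 (x + 1) (by omega) (by omega)
    simp [hy] at this
  refine card_switches_add_le_of_injOn
    (fun w => if w.2 = x then (x, x + 1) else w) ?_ ?_ ?_
  · rintro ⟨u, v⟩ hw ⟨u', v'⟩ hw' he
    simp only [Finset.mem_coe, mem_switches] at hw hw'
    simp only at he
    have hux : u ≠ x := by rintro rfl; exact hu _ hw.2
    have hux' : u' ≠ x := by rintro rfl; exact hu _ hw'.2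
    rcases eq_or_ne v x with h1 | h1 <;> rcases eq_or_ne v' x with h2 | h2
    · subst h1; subst h2
      rw [hw.2.left_unique hw'.2]
    all_goals
      split_ifs at he <;> simp_all
  · rintro ⟨u, v⟩ hw
    simp only [mem_switches] at hw ⊢
    obtain ⟨h1, hs⟩ := hw
    have hux : u ≠ x := by rintro rfl; exact hu _ hs
    split_ifs with h
    · exact ⟨by simp only; omega, by simp only; omega, hx, by simp [hy],
        by simp only; rw [hy]; exact hxk, fun z h1 h2 => by simp only at h1 h2; omega⟩
    · refine ⟨h1, hs.congr fun z hz hz' => (hd z ?_).symm⟩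
      rintro rfl
      have := hs.2.2.2.2 z (by omega) (by omega)
      simp [hdx] at this
  · rintro ⟨u, v⟩ hw u0 v0 hr hb he
    have hux : u ≠ x := by rintro rfl; exact hu _ (mem_switches.1 hw).2
    have := hk u0 v0 hr hb
    subst this
    have hs := hr.switch_left hb
    simp only at he
    rw [mem_switches] at hw
    have h5 := hw.2
    simp only at h5
    split_ifs at he with h
    · subst h
      -- Both are the last colored site before `x`. The block forces it to have color `k`, the new
      -- change forbids it.
      have huu : u = u0 := by
        have a1 := fun a => h5.2.2.2.2 u0 a hs.1
        have a2 := fun a => hs.2.2.2.2 u a h5.1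
        have a3 := h5.2.1
        have a4 := hs.2.1
        have a5 := hd u0 (by have := hs.1; omega)
        have a6 := hd u hux
        grind
      subst huu
      exact hs.2.2.2.1 (by_contra fun hne => h5.2.2.2.1 <| by
        rw [hdx, hd u hux]
        exact color_eq_of_ne hs.2.1 (by simp) hx hne hxk.symm)
    · exact hux (Prod.mk.inj he).1

open Classical in
-- If a new change `(u, v)` straddles `x`, then `x` differed in color from `u` or from `v`; the pair
-- `(u, x)` is preferred. When `x` alone is a block its color differs from that of `u`, so `(x, v)`
-- is never used.
theorem card_switches_delete_add_le {m n : ℤ} {d : ℤ → Option Bool} {x : ℤ}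
    (hx : d x ≠ none) :
    (switches m n (Function.update d x none)).card +
      ((runs m n 1 d).filter fun w => x ∈ coloredBetween d w.1 w.2).card ≤
      (switches m n d).card := by
  have hd : ∀ z, z ≠ x → Function.update d x none z = d z :=
    fun z hz => Function.update_of_ne hz _ _
  have hdx : Function.update d x none x = none := Function.update_self ..
  set d' := Function.update d x none
  have hu : ∀ v, ¬ IsSwitch d' x v := fun v h => h.2.1 hdx
  have hv : ∀ u, ¬ IsSwitch d' u x := fun v h => h.2.2.1 hdx
  refine card_switches_add_le_of_injOn (fun w => if w.1 < x ∧ x < w.2 then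
    (if d w.1 ≠ d x then (w.1, x) else (x, w.2)) else w) ?_ ?_ ?_
  · rintro ⟨u, v⟩ hw ⟨u', v'⟩ hw' he
    simp only [Finset.mem_coe, mem_switches] at hw hw'
    simp only at he
    have hux : u ≠ x := by rintro rfl; exact hu _ hw.2
    have hux' : u' ≠ x := by rintro rfl; exact hu _ hw'.2
    have hvx : v ≠ x := by rintro rfl; exact hv _ hw.2
    have hvx' : v' ≠ x := by rintro rfl; exact hv _ hw'.2
    have e1 : u = u' → (u, v) = (u', v') := by
      rintro rfl; rw [hw.2.right_unique hw'.2]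
    have e2 : v = v' → (u, v) = (u', v') := by
      rintro rfl; rw [hw.2.left_unique hw'.2]
    split_ifs at he <;> simp only [Prod.mk.injEq] at he <;>
      first | exact e1 he.1 | exact e2 he.2 | omega
  · rintro ⟨u, v⟩ hw
    simp only [mem_switches] at hw ⊢
    obtain ⟨h1, hs⟩ := hw
    have hux : u ≠ x := by rintro rfl; exact hu _ hs
    have hvx : v ≠ x := by rintro rfl; exact hv _ hs
    obtain ⟨a1, a2, a3, a4, a5⟩ := hs
    rw [hd u hux] at a2 a4
    rw [hd v hvx] at a3 a4
    split_ifs with h h'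
    · refine ⟨by simp only; omega, h.1, a2, hx, h', fun z hz hz' => ?_⟩
      simp only at hz hz'
      rw [← hd z (by omega)]
      exact a5 z (by omega) (by omega)
    · refine ⟨by simp only; omega, h.2, hx, a3, ?_, fun z hz hz' => ?_⟩
      · rw [not_not] at h'
        rwa [← h']
      · simp only at hz hz'
        rw [← hd z (by omega)]
        exact a5 z (by omega) (by omega)
    · refine ⟨h1, a1, a2, a3, a4, fun z hz hz' => ?_⟩
      simp only at hz hz' h
      rw [← hd z (by omega)]
      exact a5 z hz hz'
  · rintro ⟨u, v⟩ hw u0 v0 hr hb he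
    have h0 := (mem_switches.1 hw).2
    simp only at he h0
    have hux : u ≠ x := by rintro rfl; exact hu _ h0
    split_ifs at he with h h'
    · exact hux (Prod.mk.inj he).1
    · rw [not_not] at h'
      have hs := hr.switch_left hb
      have huu : u = u0 := by
        have a1 := fun a => h0.2.2.2.2 u0 a (by have := hs.1; omega)
        have a2 := fun a => hs.2.2.2.2 u a h.1
        have a3 := h0.2.1
        have a4 := hs.2.1
        have a5 := hd u0 (by have := hs.1; omega)
        have a6 := hd u hux
        grind
      exact hs.2.2.2.1 (huu ▸ h')
    · exact hux (Prod.mk.inj he).1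

open Classical in
-- Changes in the window that do not start at `m` do not see its color, and at most one starts
-- there.
theorem card_switches_update_left_end_le {m n : ℤ} {d : ℤ → Option Bool} {o : Option Bool} :
    (switches m n (Function.update d m o)).card ≤ (switches m n d).card + 1 := by
  set d' := Function.update d m o
  rw [← Finset.card_filter_add_card_filter_not (s := switches m n d') (fun w => w.1 ≠ m)]
  refine Nat.add_le_add (Finset.card_le_card ?_) (Finset.card_le_one.2 ?_)
  · intro w hw
    simp only [Finset.mem_filter, mem_switches] at hw ⊢
    refine ⟨hw.1.1, hw.1.2.congr fun z hz hz' => (Function.update_of_ne ?_ _ _).symm⟩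
    omega
  · rintro ⟨u, v⟩ hw ⟨u', v'⟩ hw'
    simp only [Finset.mem_filter, mem_switches, not_not] at hw hw'
    obtain ⟨⟨-, h1⟩, rfl⟩ := hw
    obtain ⟨⟨-, h2⟩, rfl⟩ := hw'
    rw [h1.right_unique h2]

open Classical in
theorem card_switches_update_right_end_le {m n : ℤ} {d : ℤ → Option Bool} {o : Option Bool} :
    (switches m n (Function.update d n o)).card ≤ (switches m n d).card + 1 := by
  set d' := Function.update d n o
  rw [← Finset.card_filter_add_card_filter_not (s := switches m n d') (fun w => w.2 ≠ n)]
  refine Nat.add_le_add (Finset.card_le_card ?_) (Finset.card_le_one.2 ?_)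
  · intro w hw
    simp only [Finset.mem_filter, mem_switches] at hw ⊢
    refine ⟨hw.1.1, hw.1.2.congr fun z hz hz' => (Function.update_of_ne ?_ _ _).symm⟩
    omega
  · rintro ⟨u, v⟩ hw ⟨u', v'⟩ hw'
    simp only [Finset.mem_filter, mem_switches, not_not] at hw hw'
    obtain ⟨⟨-, h1⟩, rfl⟩ := hw
    obtain ⟨⟨-, h2⟩, rfl⟩ := hw'
    rw [h1.left_unique h2]

/-! ### From coupled configurations to colorings. -/

/-- The color of a site: `none` if there is no discrepancy, otherwise the value of `γ`. -/
def color (s : SiteState) : Option Bool := if s.1.1 = s.1.2.2 then none else some s.1.2.1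

/-- The colors of all sites. -/
def Coupled.coloring (p : Coupled) : ℤ → Option Bool := fun x => color (p x)

theorem SiteState.cases (s : SiteState) : s = s000 ∨ s = s001 ∨ s = s011 ∨ s = s111 := by
  revert s
  decide

theorem sum_siteState (F : SiteState → ℝ) : ∑ s, F s = F s000 + F s001 + F s011 + F s111 := by
  have h : (Finset.univ : Finset SiteState) = {s000, s001, s011, s111} := by decide
  rw [h, Finset.sum_insert (by decide), Finset.sum_insert (by decide),
    Finset.sum_insert (by decide), Finset.sum_singleton]
  ring

theorem Coupled.coloring_update (p : Coupled) (x : ℤ) (s : SiteState) :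
    Coupled.coloring (Function.update p x s) = Function.update p.coloring x (color s) := by
  funext z
  rcases eq_or_ne z x with rfl | h
  · simp [Coupled.coloring]
  · simp [Coupled.coloring, h]

theorem Coupled.coloring_ne_none {p : Coupled} {x : ℤ} :
    p.coloring x ≠ none ↔ p.eta x ≠ p.zeta x := by
  simp [Coupled.coloring, color, Coupled.eta, Coupled.zeta]

theorem Coupled.coloring_eq_gamma {p : Coupled} {x : ℤ} (h : p.coloring x ≠ none) :
    p.coloring x = some (p.gamma x) := by
  have h' := Coupled.coloring_ne_none.1 h
  simp only [Coupled.eta, Coupled.zeta] at h'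
  simp [Coupled.coloring, color, Coupled.gamma, h']

theorem coloredBetween_coloring (p : Coupled) (u v : ℤ) :
    coloredBetween p.coloring u v = discBetween p u v := by
  simp only [coloredBetween, discBetween, Coupled.coloring_ne_none]

theorem isRun_coloring {l : ℕ} {p : Coupled} {u v : ℤ} :
    IsRun l p.coloring u v ↔ IsDiscInterval l p u v := by
  unfold IsRun IsDiscInterval
  rw [coloredBetween_coloring, Coupled.coloring_ne_none, Coupled.coloring_ne_none]
  refine and_congr_right fun hu => and_congr_right fun hv => and_congr_right fun _ =>
    forall₂_congr fun x hx => ?_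
  rw [← coloredBetween_coloring, mem_coloredBetween] at hx
  rw [Coupled.coloring_eq_gamma hx.2, Coupled.coloring_eq_gamma (Coupled.coloring_ne_none.2 hu),
    Coupled.coloring_eq_gamma (Coupled.coloring_ne_none.2 hv)]
  simp

theorem g_eq_card_runs (m n : ℤ) (l : ℕ) (p : Coupled) :
    g m n l p = ((runs m n l p.coloring).card : ℝ) := by
  unfold g
  congr 2
  ext w
  rw [mem_runs, isRun_coloring]
  simp

theorem Coupled.eta_le_gamma (p : Coupled) : p.eta ≤ p.gamma := fun x => (p x).2.1

theorem Coupled.gamma_le_zeta (p : Coupled) : p.gamma ≤ p.zeta := fun x => (p x).2.2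

/-! ### Jump rates of the coupling. -/

section rates

variable {c : ℤ → Config → ℝ} {p : Coupled} {x : ℤ} {s : SiteState} {ε K : ℝ}

theorem s001_ne_s000 : s001 ≠ s000 := by decide
theorem s011_ne_s000 : s011 ≠ s000 := by decide
theorem s011_ne_s001 : s011 ≠ s001 := by decide
theorem s111_ne_s000 : s111 ≠ s000 := by decide
theorem s111_ne_s001 : s111 ≠ s001 := by decide
theorem s111_ne_s011 : s111 ≠ s011 := by decide

theorem IsAttractiveNN.gamma_le_zeta_of_false (hc : IsAttractiveNN c) (h : p.zeta x = false) :
    c x p.gamma ≤ c x p.zeta :=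
  hc.birth_mono x _ _ p.gamma_le_zeta
    (by have := p.gamma_le_zeta x; rw [h] at this; exact le_bot_iff.1 this) h

theorem IsAttractiveNN.eta_le_gamma_of_false (hc : IsAttractiveNN c) (h : p.gamma x = false) :
    c x p.eta ≤ c x p.gamma :=
  hc.birth_mono x _ _ p.eta_le_gamma
    (by have := p.eta_le_gamma x; rw [h] at this; exact le_bot_iff.1 this) h

theorem IsAttractiveNN.zeta_le_gamma_of_true (hc : IsAttractiveNN c) (h : p.gamma x = true) :
    c x p.zeta ≤ c x p.gamma :=
  hc.death_anti x _ _ p.gamma_le_zeta h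
    (by have := p.gamma_le_zeta x; rw [h] at this; exact top_le_iff.1 this)

theorem IsAttractiveNN.gamma_le_eta_of_true (hc : IsAttractiveNN c) (h : p.eta x = true) :
    c x p.gamma ≤ c x p.eta :=
  hc.death_anti x _ _ p.eta_le_gamma h
    (by have := p.eta_le_gamma x; rw [h] at this; exact top_le_iff.1 this)

theorem coupledRate_nonneg (hc : IsAttractiveNN c) : 0 ≤ coupledRate c x p s := by
  have h1 := hc.nonneg x p.eta
  have h2 := hc.nonneg x p.zeta
  unfold coupledRate
  rcases SiteState.cases (p x) with h | h | h | h <;>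
    simp only [h, s001_ne_s000, s011_ne_s000, s011_ne_s001, s111_ne_s000, s111_ne_s001,
      s111_ne_s011, if_true, if_false]
  · have h3 := hc.gamma_le_zeta_of_false (p := p) (x := x) (by simp [Coupled.zeta, h, s000])
    have h4 := hc.eta_le_gamma_of_false (p := p) (x := x) (by simp [Coupled.gamma, h, s000])
    split_ifs <;> linarith
  · have h4 := hc.eta_le_gamma_of_false (p := p) (x := x) (by simp [Coupled.gamma, h, s001])
    split_ifs <;> linarith
  · have h4 := hc.zeta_le_gamma_of_true (p := p) (x := x) (by simp [Coupled.gamma, h, s011])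
    split_ifs <;> linarith
  · have h3 := hc.gamma_le_eta_of_true (p := p) (x := x) (by simp [Coupled.eta, h, s111])
    have h4 := hc.zeta_le_gamma_of_true (p := p) (x := x) (by simp [Coupled.gamma, h, s111])
    split_ifs <;> linarith

theorem coupledRate_self : coupledRate c x p (p x) = 0 := by
  unfold coupledRate
  rcases SiteState.cases (p x) with h | h | h | h <;>
    simp [h, s001_ne_s000, s011_ne_s000, s011_ne_s001, s111_ne_s000, s111_ne_s001,
      s111_ne_s011, s001_ne_s000.symm, s011_ne_s000.symm, s011_ne_s001.symm, s111_ne_s000.symm,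
      s111_ne_s001.symm, s111_ne_s011.symm]

theorem sum_coupledRate : ∑ s, coupledRate c x p s =
    if p x = s000 then c x p.zeta else if p x = s001 then c x p.gamma + c x p.zeta
    else if p x = s011 then c x p.eta + c x p.gamma else c x p.eta := by
  rw [sum_siteState]
  unfold coupledRate
  rcases SiteState.cases (p x) with h | h | h | h <;>
    simp [h, s001_ne_s000, s011_ne_s000, s011_ne_s001, s111_ne_s000, s111_ne_s001,
      s111_ne_s011, s001_ne_s000.symm, s011_ne_s000.symm, s011_ne_s001.symm, s111_ne_s000.symm,
      s111_ne_s001.symm, s111_ne_s011.symm] <;>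
    ring

theorem rate_le_half (hcK : ∀ (x : ℤ) (η ζ : Config), c x η + c x ζ ≤ K) (η : Config) :
    c x η ≤ K / 2 := by
  have := hcK x η η
  linarith

theorem bound_nonneg (hc : IsAttractiveNN c)
    (hcK : ∀ (x : ℤ) (η ζ : Config), c x η + c x ζ ≤ K) : 0 ≤ K := by
  have h1 := hcK 0 (fun _ => false) (fun _ => false)
  have h2 := hc.nonneg 0 (fun _ => false)
  linarith

theorem sum_coupledRate_le (hc : IsAttractiveNN c)
    (hcK : ∀ (x : ℤ) (η ζ : Config), c x η + c x ζ ≤ K) : ∑ s, coupledRate c x p s ≤ K := by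
  have h1 := rate_le_half (x := x) hcK p.eta
  have h2 := rate_le_half (x := x) hcK p.zeta
  have h3 := rate_le_half (x := x) hcK p.gamma
  have h4 := bound_nonneg hc hcK
  rw [sum_coupledRate]
  split_ifs <;> linarith

/-- Where the three coordinates agree, the rates telescope to the rate of a single configuration. -/
theorem sum_coupledRate_le_half (hcK : ∀ (x : ℤ) (η ζ : Config), c x η + c x ζ ≤ K)
    (h : p.coloring x = none) : ∑ s, coupledRate c x p s ≤ K / 2 := by
  have h1 := rate_le_half (x := x) hcK p.eta
  have h2 := rate_le_half (x := x) hcK p.zeta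
  rw [sum_coupledRate]
  rcases SiteState.cases (p x) with h' | h' | h' | h' <;>
    simp [Coupled.coloring, color, h', s001, s011] at h <;>
    simp [h', s111_ne_s000, s111_ne_s001, s111_ne_s011, h1, h2]

/-- Two of the configurations differ exactly at the sites of color `k`: `γ, ζ` for `false` and `η,
γ` for `true`. If none of `x - 1`, `x`, `x + 1` has color `k`, these two have equal rates at `x`,
and a jump into the only state of color `k` has the difference of these rates or zero as its rate.
-/
theorem neighbor_colored_of_coupledRate_ne_zero (hc : IsAttractiveNN c) {k : Bool}
    (hs : color s = some k) (hx : p.coloring x ≠ some k) (h : coupledRate c x p s ≠ 0) :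
    p.coloring (x - 1) = some k ∨ p.coloring (x + 1) = some k := by
  have e1 : ∀ z, p.coloring z ≠ some false → p.gamma z = p.zeta z := by
    intro z hz
    simp only [Coupled.coloring, Coupled.gamma, Coupled.zeta] at *
    generalize p z = t at *
    revert t
    decide
  have e2 : ∀ z, p.coloring z ≠ some true → p.eta z = p.gamma z := by
    intro z hz
    simp only [Coupled.coloring, Coupled.gamma, Coupled.eta] at *
    generalize p z = t at *
    revert t
    decide
  by_contra hcon
  rw [not_or] at hcon
  apply h
  cases k with
  | false =>
    have h1 : c x p.gamma = c x p.zeta :=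
      hc.nearest x _ _ (e1 _ hcon.1) (e1 _ hx) (e1 _ hcon.2)
    have h2 : s = s001 := by clear h; revert s; decide
    have h3 : p x ≠ s001 := fun h => hx (by simp only [Coupled.coloring, h]; decide)
    subst h2
    simp [coupledRate, h1, h3, s001_ne_s000, s011_ne_s001.symm, s111_ne_s001.symm]
  | true =>
    have h1 : c x p.eta = c x p.gamma :=
      hc.nearest x _ _ (e2 _ hcon.1) (e2 _ hx) (e2 _ hcon.2)
    have h2 : s = s011 := by clear h; revert s; decide
    have h3 : p x ≠ s011 := fun h => hx (by simp only [Coupled.coloring, h]; decide)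
    subst h2
    simp [coupledRate, h1, h3, s011_ne_s000, s011_ne_s001, s111_ne_s011.symm]

/-- If both neighbors are 0, raising one makes them differ and, by attractiveness, does not increase
the death rate. -/
theorem le_death_rate (hc : IsAttractiveNN c)
    (hcε : ∀ (x : ℤ) (η : Config), η (x - 1) ≠ η (x + 1) → ε ≤ c x η) {θ : Config}
    (hx : θ x = true) (h : θ (x - 1) = false ∨ θ (x + 1) = false) : ε ≤ c x θ := by
  by_cases hne : θ (x - 1) = θ (x + 1)
  · have h1 : θ (x + 1) = false := by rcases h with h | h; exacts [hne ▸ h, h]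
    refine (hcε x (Function.update θ (x + 1) true) ?_).trans
      (hc.death_anti x _ _ ?_ hx ?_)
    · rw [Function.update_self, Function.update_of_ne (by omega), hne, h1]
      decide
    · rw [le_update_iff]
      exact ⟨by rw [h1]; decide, fun _ _ => le_rfl⟩
    · rw [Function.update_of_ne (by omega), hx]
  · exact hcε x θ hne

theorem le_birth_rate (hc : IsAttractiveNN c)
    (hcε : ∀ (x : ℤ) (η : Config), η (x - 1) ≠ η (x + 1) → ε ≤ c x η) {θ : Config}
    (hx : θ x = false) (h : θ (x - 1) = true ∨ θ (x + 1) = true) : ε ≤ c x θ := by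
  by_cases hne : θ (x - 1) = θ (x + 1)
  · have h1 : θ (x + 1) = true := by rcases h with h | h; exacts [hne ▸ h, h]
    refine (hcε x (Function.update θ (x + 1) false) ?_).trans
      (hc.birth_mono x _ _ ?_ ?_ hx)
    · rw [Function.update_self, Function.update_of_ne (by omega), hne, h1]
      decide
    · rw [update_le_iff]
      exact ⟨by rw [h1]; decide, fun _ _ => le_rfl⟩
    · rw [Function.update_of_ne (by omega), hx]
  · exact hcε x θ hne

/-- At `s001` the total rate is that of `γ` plus that of `ζ`. A neighbor without this color has `ζ =
0` or `γ = 1`, which makes the death of `ζ` or the birth of `γ` have rate at least `ε`. At `s011`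
the same holds with `η, γ`. -/
theorem le_sum_coupledRate (hc : IsAttractiveNN c)
    (hcε : ∀ (x : ℤ) (η : Config), η (x - 1) ≠ η (x + 1) → ε ≤ c x η)
    (hx : p.coloring x ≠ none)
    (h : p.coloring (x - 1) ≠ p.coloring x ∨ p.coloring (x + 1) ≠ p.coloring x) :
    ε ≤ ∑ s, coupledRate c x p s := by
  have n1 := hc.nonneg x p.eta
  have n2 := hc.nonneg x p.gamma
  have n3 := hc.nonneg x p.zeta
  rw [sum_coupledRate]
  rcases SiteState.cases (p x) with h' | h' | h' | h'
  · exact absurd (by simp only [Coupled.coloring, h']; decide) hx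
  · have key : ∀ z, p.coloring z ≠ p.coloring x → p.zeta z = false ∨ p.gamma z = true := by
      intro z hz
      simp only [Coupled.coloring, Coupled.gamma, Coupled.zeta, h'] at *
      generalize p z = t at *
      revert t
      decide
    have z1 : p.zeta x = true := by simp [Coupled.zeta, h', s001]
    have g1 : p.gamma x = false := by simp [Coupled.gamma, h', s001]
    have : ε ≤ c x p.zeta ∨ ε ≤ c x p.gamma := by
      rcases h with h | h <;> rcases key _ h with h2 | h2
      · exact Or.inl (le_death_rate hc hcε z1 (Or.inl h2))
      · exact Or.inr (le_birth_rate hc hcε g1 (Or.inl h2))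
      · exact Or.inl (le_death_rate hc hcε z1 (Or.inr h2))
      · exact Or.inr (le_birth_rate hc hcε g1 (Or.inr h2))
    rw [if_neg (by rw [h']; decide), if_pos h']
    rcases this with h | h <;> linarith
  · have key : ∀ z, p.coloring z ≠ p.coloring x → p.gamma z = false ∨ p.eta z = true := by
      intro z hz
      simp only [Coupled.coloring, Coupled.gamma, Coupled.eta, h'] at *
      generalize p z = t at *
      revert t
      decide
    have z1 : p.gamma x = true := by simp [Coupled.gamma, h', s011]
    have g1 : p.eta x = false := by simp [Coupled.eta, h', s011]
    have : ε ≤ c x p.gamma ∨ ε ≤ c x p.eta := by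
      rcases h with h | h <;> rcases key _ h with h2 | h2
      · exact Or.inl (le_death_rate hc hcε z1 (Or.inl h2))
      · exact Or.inr (le_birth_rate hc hcε g1 (Or.inl h2))
      · exact Or.inl (le_death_rate hc hcε z1 (Or.inr h2))
      · exact Or.inr (le_birth_rate hc hcε g1 (Or.inr h2))
    rw [if_neg (by rw [h']; decide), if_neg (by rw [h']; decide), if_pos h']
    rcases this with h | h <;> linarith
  · exact absurd (by simp only [Coupled.coloring, h']; decide) hx

end rates

/-! ### The generator on functions of finitely many sites. -/

theorem coupledGen_eq_sum (c : ℤ → Config → ℝ) {f : Coupled → ℝ} {F : Finset ℤ}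
    (hf : DependsOn f (F : Set ℤ)) (p : Coupled) :
    coupledGen c f p =
      ∑ x ∈ F, ∑ s, coupledRate c x p s * (f (Function.update p x s) - f p) := by
  refine finsum_eq_sum_of_support_subset _ fun x hx => ?_
  by_contra hxF
  refine hx (Finset.sum_eq_zero fun s _ => ?_)
  rw [hf (x := Function.update p x s) (y := p), sub_self, mul_zero]
  intro i hi
  exact Function.update_of_ne (by rintro rfl; exact hxF hi) _ _

theorem runs_congr {m n : ℤ} {l : ℕ} {d d' : ℤ → Option Bool}
    (h : ∀ x ∈ Finset.Icc m n, d x = d' x) : runs m n l d = runs m n l d' := by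
  ext w
  rw [mem_runs, mem_runs]
  refine and_congr_right fun hw => ?_
  have hd : ∀ z, m ≤ z → z ≤ n → d z = d' z := fun z h1 h2 => h z (Finset.mem_Icc.2 ⟨h1, h2⟩)
  have hb : coloredBetween d w.1 w.2 = coloredBetween d' w.1 w.2 := by
    ext z
    rw [mem_coloredBetween, mem_coloredBetween]
    refine and_congr_right fun hz => ?_
    rw [hd z (by omega) (by omega)]
  unfold IsRun
  rw [hb, hd w.1 hw.1.1 hw.1.2, hd w.2 hw.2.1 hw.2.2]
  refine and_congr_right fun _ => and_congr_right fun _ => and_congr_right fun _ =>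
    forall₂_congr fun z hz => ?_
  have := mem_coloredBetween.1 hz
  rw [hd z (by omega) (by omega)]

theorem switches_congr {m n : ℤ} {d d' : ℤ → Option Bool}
    (h : ∀ x ∈ Finset.Icc m n, d x = d' x) : switches m n d = switches m n d' := by
  ext w
  rw [mem_switches, mem_switches]
  refine and_congr_right fun hw => ?_
  have hd : ∀ z, m ≤ z → z ≤ n → d z = d' z := fun z h1 h2 => h z (Finset.mem_Icc.2 ⟨h1, h2⟩)
  constructor
  · intro hs
    exact hs.congr fun z _ _ => (hd z (by omega) (by omega)).symm
  · intro hs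
    exact hs.congr fun z _ _ => hd z (by omega) (by omega)

theorem dependsOn_g (m n : ℤ) (l : ℕ) :
    DependsOn (g m n l) ((Finset.Icc m n : Finset ℤ) : Set ℤ) := by
  intro p q h
  rw [g_eq_card_runs, g_eq_card_runs, runs_congr]
  intro x hx
  simp only [Coupled.coloring, h x hx]

theorem dependsOn_switches (m n : ℤ) :
    DependsOn (fun p : Coupled => ((switches m n p.coloring).card : ℝ))
      ((Finset.Icc m n : Finset ℤ) : Set ℤ) := by
  intro p q h
  simp only
  rw [switches_congr]
  intro x hx
  simp only [Coupled.coloring, h x hx]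

/-! ### Drift of the number of blocks and of the number of color changes. -/

section drift

variable {c : ℤ → Config → ℝ} {ε K : ℝ}

open Classical in
-- The first two terms account for a jump at a colored `x`, the last for a color entering an
-- uncolored `x` from a neighbor.
theorem le_drift_g_site (hc : IsAttractiveNN c)
    (hcε : ∀ (x : ℤ) (η : Config), η (x - 1) ≠ η (x + 1) → ε ≤ c x η)
    (hcK : ∀ (x : ℤ) (η ζ : Config), c x η + c x ζ ≤ K) {l : ℕ} (hl : 1 ≤ l) {m n x : ℤ}
    (hx : x ∈ Finset.Icc m n) (p : Coupled) :
    ε * ((runs m n (l + 1) p.coloring).filter fun w => x ∈ coloredBetween p.coloring w.1 w.2 ∧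
          ∀ z ∈ coloredBetween p.coloring w.1 w.2, x ≤ z).card
      - K * ((runs m n l p.coloring).filter fun w =>
          w.1 = x ∨ w.2 = x ∨ x ∈ coloredBetween p.coloring w.1 w.2).card
      - K / 2 * (((runs m n l p.coloring).filter fun w =>
          x - 1 ∈ coloredBetween p.coloring w.1 w.2).card +
        ((runs m n l p.coloring).filter fun w =>
          x + 1 ∈ coloredBetween p.coloring w.1 w.2).card) ≤
      ∑ s, coupledRate c x p s * (g m n l (Function.update p x s) - g m n l p) := by
  have hK := bound_nonneg hc hcK
  obtain ⟨hmx, hxn⟩ := Finset.mem_Icc.1 hx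
  simp only [g_eq_card_runs, Coupled.coloring_update]
  have hr : ∀ s, 0 ≤ coupledRate c x p s := fun s => coupledRate_nonneg hc
  set J := (runs m n (l + 1) p.coloring).filter fun w =>
    x ∈ coloredBetween p.coloring w.1 w.2 ∧
          ∀ z ∈ coloredBetween p.coloring w.1 w.2, x ≤ z with hJ
  set T := (runs m n l p.coloring).filter fun w =>
          w.1 = x ∨ w.2 = x ∨ x ∈ coloredBetween p.coloring w.1 w.2 with hT
  set N₁ := (runs m n l p.coloring).filter fun w =>
          x - 1 ∈ coloredBetween p.coloring w.1 w.2 with hN₁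
  set N₂ := (runs m n l p.coloring).filter fun w =>
          x + 1 ∈ coloredBetween p.coloring w.1 w.2 with hN₂
  have hJ0 : (0 : ℝ) ≤ J.card := Nat.cast_nonneg _
  have hT0 : (0 : ℝ) ≤ T.card := Nat.cast_nonneg _
  have h10 : (0 : ℝ) ≤ N₁.card := Nat.cast_nonneg _
  have h20 : (0 : ℝ) ≤ N₂.card := Nat.cast_nonneg _
  by_cases hd : p.coloring x = none
  · have hJe : J = ∅ := Finset.filter_eq_empty_iff.2 fun w _ h =>
      (mem_coloredBetween.1 h.1).2 hd
    have h1 : ∀ s, coupledRate c x p s * (-(N₁.card + N₂.card : ℝ)) ≤ coupledRate c x p s *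
        ((runs m n l (Function.update p.coloring x (color s))).card -
          (runs m n l p.coloring).card : ℝ) := by
      intro s
      rcases eq_or_ne (coupledRate c x p s) 0 with h0 | h0
      · simp [h0]
      refine mul_le_mul_of_nonneg_left ?_ (hr s)
      rcases hcol : color s with _ | k
      · rw [← hd, Function.update_eq_self]
        linarith
      · rcases neighbor_colored_of_coupledRate_ne_zero hc hcol (by simp [hd]) h0 with h | h
        · have := card_runs_le_insert_left (m := m) (n := n) hl hd h hxn
          have : ((runs m n l p.coloring).card : ℝ) ≤
            (runs m n l (Function.update p.coloring x (some k))).card + N₁.card := by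
            exact_mod_cast this
          linarith
        · have := card_runs_le_insert_right (m := m) (n := n) hl hd h hmx
          have : ((runs m n l p.coloring).card : ℝ) ≤
            (runs m n l (Function.update p.coloring x (some k))).card + N₂.card := by
            exact_mod_cast this
          linarith
    refine le_trans ?_ (Finset.sum_le_sum fun s _ => h1 s)
    rw [← Finset.sum_mul, hJe]
    have h3 := mul_le_mul_of_nonneg_right (sum_coupledRate_le_half (c := c) hcK hd)
      (add_nonneg h10 h20)
    have h4 := mul_nonneg hK hT0
    simp only [Finset.card_empty, Nat.cast_zero, mul_zero]
    linarith
  · have h1 : ∀ s, coupledRate c x p s * (J.card - T.card : ℝ) ≤ coupledRate c x p s *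
        ((runs m n l (Function.update p.coloring x (color s))).card -
          (runs m n l p.coloring).card : ℝ) := by
      intro s
      rcases eq_or_ne (coupledRate c x p s) 0 with h0 | h0
      · simp [h0]
      refine mul_le_mul_of_nonneg_left ?_ (hr s)
      have hne : color s ≠ p.coloring x := by
        intro h
        have hs : s = p x := by
          simp only [Coupled.coloring] at h hd
          clear h0
          generalize p x = t at h hd
          revert s t
          decide
        exact h0 (hs ▸ coupledRate_self)
      have := card_runs_add_le_exit (m := m) (n := n) hl hd hne
      have : ((runs m n l p.coloring).card : ℝ) + J.card ≤
          (runs m n l (Function.update p.coloring x (color s))).card + T.card := by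
        exact_mod_cast this
      linarith
    refine le_trans ?_ (Finset.sum_le_sum fun s _ => h1 s)
    rw [← Finset.sum_mul]
    have h2 : ε * J.card ≤ (∑ s, coupledRate c x p s) * J.card := by
      rcases J.eq_empty_or_nonempty with hJe | ⟨w, hw⟩
      · simp [hJe]
      -- Since `x` is the first site of its block, `x - 1` is either the bound, of the other color,
      -- or uncolored.
      · refine mul_le_mul_of_nonneg_right (le_sum_coupledRate hc hcε hd (Or.inl ?_)) hJ0
        simp only [hJ, Finset.mem_filter, mem_runs] at hw
        obtain ⟨⟨-, hrun⟩, hb, hfirst⟩ := hw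
        have hxb := mem_coloredBetween.1 hb
        intro heq
        rcases eq_or_ne w.1 (x - 1) with h | h
        · exact (hrun.2.2.2 x hb).1 (h ▸ heq.symm)
        · have := hfirst (x - 1) (mem_coloredBetween.2 ⟨by omega, heq ▸ hd⟩)
          omega
    have h3 := mul_le_mul_of_nonneg_right (sum_coupledRate_le (x := x) (p := p) hc hcK) hT0
    have h4 := mul_nonneg (div_nonneg hK zero_le_two) (add_nonneg h10 h20)
    rw [mul_sub]
    linarith

end drift

theorem sum_card_filter_comm {α β : Type*} (A : Finset α) (B : Finset β) (P : α → β → Prop)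
    [∀ a, DecidablePred (P a)] [∀ b, DecidablePred fun a => P a b] :
    ∑ a ∈ A, ((B.filter fun b => P a b).card : ℝ) =
      ∑ b ∈ B, ((A.filter fun a => P a b).card : ℝ) := by
  simp only [Finset.card_filter, Nat.cast_sum, Nat.cast_ite, Nat.cast_one, Nat.cast_zero]
  rw [Finset.sum_comm]

theorem IsRun.exists_first {l : ℕ} {d : ℤ → Option Bool} {u v : ℤ} (h : IsRun l d u v)
    (hl : 1 ≤ l) : ∃ x ∈ coloredBetween d u v, ∀ z ∈ coloredBetween d u v, x ≤ z :=
  Finset.exists_min_image _ id (Finset.card_pos.1 (by rw [h.2.2.1]; omega))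

section drift

variable {c : ℤ → Config → ℝ} {ε K : ℝ}

theorem le_coupledGen_g (hc : IsAttractiveNN c) (hε : 0 ≤ ε)
    (hcε : ∀ (x : ℤ) (η : Config), η (x - 1) ≠ η (x + 1) → ε ≤ c x η)
    (hcK : ∀ (x : ℤ) (η ζ : Config), c x η + c x ζ ≤ K) {l : ℕ} (hl : 1 ≤ l) (m n : ℤ)
    (p : Coupled) :
    ε * g m n (l + 1) p - K * (2 * l + 2) * g m n l p ≤ coupledGen c (g m n l) p := by
  classical
  have hK := bound_nonneg hc hcK
  rw [coupledGen_eq_sum c (dependsOn_g m n l)]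
  refine le_trans ?_ (Finset.sum_le_sum fun x hx => le_drift_g_site hc hcε hcK hl hx p)
  simp only [Finset.sum_sub_distrib, ← Finset.mul_sum, Finset.sum_add_distrib]
  -- Double counting: sums over sites become sums over blocks. Each long block has a first site;
  -- each short one is touched by at most `l + 2` sites and has `l` sites on either shift.
  iterate 4 rw [sum_card_filter_comm (Finset.Icc m n)]
  rw [g_eq_card_runs, g_eq_card_runs]
  set d := p.coloring
  have hJ : ((runs m n (l + 1) d).card : ℝ) ≤ ∑ w ∈ runs m n (l + 1) d,
      (((Finset.Icc m n).filter fun x => x ∈ coloredBetween d w.1 w.2 ∧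
          ∀ z ∈ coloredBetween d w.1 w.2, x ≤ z).card : ℝ) := by
    rw [Finset.cast_card]
    refine Finset.sum_le_sum fun w hw => ?_
    rw [mem_runs] at hw
    obtain ⟨x, hx, hx'⟩ := hw.2.exists_first (by omega)
    have hxb := mem_coloredBetween.1 hx
    refine Nat.one_le_cast.2 (Nat.succ_le_of_lt (Finset.card_pos.2 ⟨x, Finset.mem_filter.2
      ⟨Finset.mem_Icc.2 ⟨by omega, by omega⟩, hx, hx'⟩⟩))
  have hT : ∑ w ∈ runs m n l d, (((Finset.Icc m n).filter fun x => w.1 = x ∨ w.2 = x ∨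
      x ∈ coloredBetween d w.1 w.2).card : ℝ) ≤ (runs m n l d).card * (l + 2 : ℝ) := by
    rw [← nsmul_eq_mul]
    refine Finset.sum_le_card_nsmul _ _ _ fun w hw => ?_
    rw [mem_runs] at hw
    have h1 : ((Finset.Icc m n).filter fun x => w.1 = x ∨ w.2 = x ∨
        x ∈ coloredBetween d w.1 w.2) ⊆ insert w.1 (insert w.2 (coloredBetween d w.1 w.2)) := by
      intro x hx
      have := (Finset.mem_filter.1 hx).2
      rw [Finset.mem_insert, Finset.mem_insert]
      tauto
    have h2 := (Finset.card_le_card h1).trans ((Finset.card_insert_le _ _).trans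
      (Nat.add_le_add_right (Finset.card_insert_le _ _) 1))
    rw [hw.2.2.2.1] at h2
    exact_mod_cast h2
  have hN : ∀ a : ℤ, ∑ w ∈ runs m n l d, (((Finset.Icc m n).filter fun x =>
      x + a ∈ coloredBetween d w.1 w.2).card : ℝ) ≤ (runs m n l d).card * (l : ℝ) := by
    intro a
    rw [← nsmul_eq_mul]
    refine Finset.sum_le_card_nsmul _ _ _ fun w hw => ?_
    rw [mem_runs] at hw
    rw [← hw.2.2.2.1]
    exact_mod_cast Finset.card_le_card_of_injOn (fun x => x + a)
      (fun x hx => (Finset.mem_filter.1 hx).2) (fun _ _ _ _ h => add_right_cancel h)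
  have hN₁ := hN (-1)
  have hN₂ := hN 1
  simp only [← sub_eq_add_neg] at hN₁
  have hJ' := mul_le_mul_of_nonneg_left hJ hε
  have hT' := mul_le_mul_of_nonneg_left hT hK
  have hN' := mul_le_mul_of_nonneg_left (add_le_add hN₁ hN₂) (div_nonneg hK zero_le_two)
  refine le_trans ?_ (sub_le_sub (sub_le_sub hJ' hT') hN')
  linarith

/-- `2l + 2 ≤ 4l` for `l ≥ 1`; the term with `2ε` is slack. -/
theorem le_coupledGen_g_of_four_mul (hc : IsAttractiveNN c) (hε : 0 ≤ ε)
    (hcε : ∀ (x : ℤ) (η : Config), η (x - 1) ≠ η (x + 1) → ε ≤ c x η)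
    (hcK : ∀ (x : ℤ) (η ζ : Config), c x η + c x ζ ≤ K) {l : ℕ} (hl : 1 ≤ l) (m n : ℤ)
    (p : Coupled) :
    ε * (g m n (l + 1) p - 2 * g m n l p) - 4 * K * (l : ℝ) * g m n l p ≤
      coupledGen c (g m n l) p := by
  have hK := bound_nonneg hc hcK
  have hg : 0 ≤ g m n l p := Nat.cast_nonneg _
  have hl' : (1 : ℝ) ≤ l := by exact_mod_cast hl
  have h1 := le_coupledGen_g hc hε hcε hcK hl m n p
  have h2 := mul_nonneg (mul_nonneg hK hg) (sub_nonneg.2 hl')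
  have h3 := mul_nonneg hε hg
  linarith

open Classical in
theorem drift_switches_site_le (hc : IsAttractiveNN c)
    (hcε : ∀ (x : ℤ) (η : Config), η (x - 1) ≠ η (x + 1) → ε ≤ c x η)
    (hcK : ∀ (x : ℤ) (η ζ : Config), c x η + c x ζ ≤ K) {m n x : ℤ}
    (hx : x ∈ Finset.Icc m n) (p : Coupled) :
    ∑ s, coupledRate c x p s * (((switches m n (Coupled.coloring (Function.update p x s))).card : ℝ)
        - (switches m n p.coloring).card) ≤
      (if x = m then K else 0) + (if x = n then K else 0) -
      ε * ((runs m n 1 p.coloring).filter fun w =>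
          x ∈ coloredBetween p.coloring w.1 w.2).card := by
  have hK := bound_nonneg hc hcK
  obtain ⟨hmx, hxn⟩ := Finset.mem_Icc.1 hx
  simp only [Coupled.coloring_update]
  have hr : ∀ s, 0 ≤ coupledRate c x p s := fun s => coupledRate_nonneg hc
  set R := (runs m n 1 p.coloring).filter fun w =>
          x ∈ coloredBetween p.coloring w.1 w.2 with hR
  have hR0 : (0 : ℝ) ≤ R.card := Nat.cast_nonneg _
  by_cases hend : x = m ∨ x = n
  -- Sites of a block lie strictly between its bounds, hence are never ends of the window.
  · have hRe : R = ∅ := Finset.filter_eq_empty_iff.2 fun w hw h => by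
      have h1 := mem_coloredBetween.1 h
      have h2 := mem_runs.1 hw
      omega
    have h1 : ∀ s, coupledRate c x p s *
        (((switches m n (Function.update p.coloring x (color s))).card : ℝ) -
          (switches m n p.coloring).card) ≤ coupledRate c x p s := by
      intro s
      refine mul_le_of_le_one_right (hr s) ?_
      have : (switches m n (Function.update p.coloring x (color s))).card ≤
          (switches m n p.coloring).card + 1 := by
        rcases hend with rfl | rfl
        · exact card_switches_update_left_end_le
        · exact card_switches_update_right_end_le
      have : ((switches m n (Function.update p.coloring x (color s))).card : ℝ) ≤
          (switches m n p.coloring).card + 1 := by exact_mod_cast this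
      linarith
    refine (Finset.sum_le_sum fun s _ => h1 s).trans ((sum_coupledRate_le hc hcK).trans ?_)
    rw [hRe]
    simp only [Finset.card_empty, Nat.cast_zero, mul_zero, sub_zero]
    split_ifs <;> first | linarith | omega
  rw [not_or] at hend
  rw [if_neg hend.1, if_neg hend.2]
  have h1 : ∀ s, coupledRate c x p s *
        (((switches m n (Function.update p.coloring x (color s))).card : ℝ) -
          (switches m n p.coloring).card) ≤ coupledRate c x p s * (-R.card) := by
    intro s
    rcases eq_or_ne (coupledRate c x p s) 0 with h0 | h0
    · simp [h0]
    refine mul_le_mul_of_nonneg_left ?_ (hr s)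
    suffices h : (switches m n (Function.update p.coloring x (color s))).card + R.card ≤
        (switches m n p.coloring).card by
      have : ((switches m n (Function.update p.coloring x (color s))).card : ℝ) + R.card ≤
        (switches m n p.coloring).card := by exact_mod_cast h
      linarith
    by_cases hd : p.coloring x = none
    · have hRe : R = ∅ := Finset.filter_eq_empty_iff.2 fun w _ h =>
        (mem_coloredBetween.1 h).2 hd
      rw [hRe, Finset.card_empty, add_zero]
      rcases hcol : color s with _ | k
      · rw [← hd, Function.update_eq_self]
      · rcases neighbor_colored_of_coupledRate_ne_zero hc hcol (by simp [hd]) h0 with h | h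
        · exact card_switches_insert_left_le hd h (by omega)
        · exact card_switches_insert_right_le hd h (by omega)
    · rcases hcol : color s with _ | k
      · exact card_switches_delete_add_le hd
      · have hne : p.coloring x ≠ some k := by
          intro h
          have hs : s = p x := by
            rw [← hcol] at h
            simp only [Coupled.coloring] at h hd
            clear h0 hcol
            generalize p x = t at h hd
            revert s t
            decide
          exact h0 (hs ▸ coupledRate_self)
        rcases neighbor_colored_of_coupledRate_ne_zero hc hcol hne h0 with h | h
        · exact card_switches_flip_left_add_le hd hne h (by omega) hxn
        · exact card_switches_flip_right_add_le hd hne h hmx (by omega)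
  refine (Finset.sum_le_sum fun s _ => h1 s).trans ?_
  rw [← Finset.sum_mul]
  have h2 : ε * R.card ≤ (∑ s, coupledRate c x p s) * R.card := by
    rcases R.eq_empty_or_nonempty with hRe | ⟨w, hw⟩
    · simp [hRe]
    · simp only [hR, Finset.mem_filter, mem_runs] at hw
      obtain ⟨⟨-, hrun⟩, hb⟩ := hw
      have hxb := mem_coloredBetween.1 hb
      refine mul_le_mul_of_nonneg_right (le_sum_coupledRate hc hcε hxb.2 (Or.inl ?_)) hR0
      intro heq
      rcases eq_or_ne w.1 (x - 1) with h | h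
      · exact (hrun.2.2.2 x hb).1 (h ▸ heq.symm)
      · have := hrun.eq_none_of_one hb (z := x - 1) (by omega) (by omega) (by omega)
        exact hxb.2 (heq ▸ this)
  linarith

/-- Only the two end sites can create color changes, so the positive part of the drift does not
depend on the window. -/
theorem coupledGen_switches_le (hc : IsAttractiveNN c) (hε : 0 ≤ ε)
    (hcε : ∀ (x : ℤ) (η : Config), η (x - 1) ≠ η (x + 1) → ε ≤ c x η)
    (hcK : ∀ (x : ℤ) (η ζ : Config), c x η + c x ζ ≤ K) (m n : ℤ) (p : Coupled) :
    coupledGen c (fun p => ((switches m n p.coloring).card : ℝ)) p ≤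
      2 * K - ε * g m n 1 p := by
  classical
  have hK := bound_nonneg hc hcK
  rw [coupledGen_eq_sum c (dependsOn_switches m n)]
  refine (Finset.sum_le_sum fun x hx => drift_switches_site_le hc hcε hcK hx p).trans ?_
  simp only [Finset.sum_sub_distrib, ← Finset.mul_sum, Finset.sum_add_distrib,
    Finset.sum_ite_eq']
  rw [sum_card_filter_comm (Finset.Icc m n), g_eq_card_runs]
  set d := p.coloring
  have hR : ((runs m n 1 d).card : ℝ) ≤ ∑ w ∈ runs m n 1 d,
      (((Finset.Icc m n).filter fun x => x ∈ coloredBetween d w.1 w.2).card : ℝ) := by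
    rw [Finset.cast_card]
    refine Finset.sum_le_sum fun w hw => ?_
    rw [mem_runs] at hw
    obtain ⟨x, hx, -⟩ := hw.2.exists_first le_rfl
    have hxb := mem_coloredBetween.1 hx
    refine Nat.one_le_cast.2 (Nat.succ_le_of_lt (Finset.card_pos.2 ⟨x, Finset.mem_filter.2
      ⟨Finset.mem_Icc.2 ⟨by omega, by omega⟩, hx⟩⟩))
  have hR' := mul_le_mul_of_nonneg_left hR hε
  refine (sub_le_sub_left hR' _).trans ?_
  split_ifs <;> linarith

end drift

/-! ### Stationarity and the integrated bounds. -/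

theorem continuous_of_dependsOn {f : Coupled → ℝ} {F : Finset ℤ}
    (hf : DependsOn f (F : Set ℤ)) : Continuous f := by
  refine continuous_iff_continuousAt.2 fun p => ?_
  have h : ∀ᶠ q in 𝓝 p, ∀ x ∈ F, q x = p x := by
    rw [Finset.eventually_all]
    intro x _
    have hx : IsOpen ((fun q : Coupled => q x) ⁻¹' {p x}) :=
      (isOpen_discrete _).preimage (continuous_apply x)
    exact hx.mem_nhds rfl
  refine (continuousAt_const (y := f p)).congr ?_
  filter_upwards [h] with q hq
  exact hf fun x hx => (hq x hx).symm

theorem integrable_of_continuous {f : Coupled → ℝ} (hf : Continuous f) (ν : Measure Coupled)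
    [IsFiniteMeasure ν] : Integrable f ν :=
  hf.integrable_of_hasCompactSupport (HasCompactSupport.of_compactSpace f)

section stationary

variable {c : ℤ → Config → ℝ} {S : ℝ≥0 → C(Coupled, ℝ) →ₗ[ℝ] C(Coupled, ℝ)}
  {f : Coupled → ℝ} {F : Finset ℤ}

theorem IsCoupledSemigroup.continuous_coupledGen (hS : IsCoupledSemigroup c S)
    (hf : DependsOn f (F : Set ℤ)) : Continuous (coupledGen c f) :=
  (hS.generator ⟨f, continuous_of_dependsOn hf⟩ ⟨F, hf⟩).continuous
    (Frequently.of_forall fun t => by fun_prop)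

/-- By invariance the difference quotients of the semigroup have integral zero, and they converge to
the generator uniformly. -/
theorem IsCoupledSemigroup.integral_coupledGen_eq_zero (hS : IsCoupledSemigroup c S)
    (hf : DependsOn f (F : Set ℤ)) {ν : Measure Coupled} [IsProbabilityMeasure ν]
    (hν : IsInvariant S ν) : ∫ p, coupledGen c f p ∂ν = 0 := by
  set f' : C(Coupled, ℝ) := ⟨f, continuous_of_dependsOn hf⟩
  have hgen := hS.generator f' ⟨F, hf⟩
  have hzero : ∀ t : ℝ≥0, ∫ p, (S t f' p - f' p) / (t : ℝ) ∂ν = 0 := by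
    intro t
    rw [integral_div, integral_sub (integrable_of_continuous (S t f').continuous ν)
      (integrable_of_continuous f'.continuous ν), hν t f', sub_self, zero_div]
  have hcont := hS.continuous_coupledGen hf
  refine abs_eq_zero.1 (le_antisymm (le_of_forall_pos_le_add fun δ hδ => ?_) (abs_nonneg _))
  obtain ⟨t, ht⟩ := (Metric.tendstoUniformly_iff.1 hgen δ hδ).exists
  have hint : Integrable (fun p => (S t f' p - f' p) / (t : ℝ)) ν :=
    integrable_of_continuous (by fun_prop) ν
  rw [zero_add, ← sub_zero (∫ p, coupledGen c f p ∂ν), ← hzero t,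
    ← integral_sub (integrable_of_continuous hcont ν) hint, ← Real.norm_eq_abs]
  refine (norm_integral_le_of_norm_le_const (C := δ) (.of_forall fun p => ?_)).trans ?_
  · exact (ht p).le
  · simp

end stationary

section invariant

variable {c : ℤ → Config → ℝ} {ε K : ℝ} {S : ℝ≥0 → C(Coupled, ℝ) →ₗ[ℝ] C(Coupled, ℝ)}
  {ν : Measure Coupled} [IsProbabilityMeasure ν]

theorem integrable_g (m n : ℤ) (l : ℕ) : Integrable (g m n l) ν :=
  integrable_of_continuous (continuous_of_dependsOn (dependsOn_g m n l)) ν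

theorem integral_g_succ_le (hc : IsAttractiveNN c) (hε : 0 ≤ ε)
    (hcε : ∀ (x : ℤ) (η : Config), η (x - 1) ≠ η (x + 1) → ε ≤ c x η)
    (hcK : ∀ (x : ℤ) (η ζ : Config), c x η + c x ζ ≤ K) (hS : IsCoupledSemigroup c S)
    (hν : IsInvariant S ν) {l : ℕ} (hl : 1 ≤ l) (m n : ℤ) :
    ε * ∫ p, g m n (l + 1) p ∂ν ≤ (4 * K * (l : ℝ) + 2 * ε) * ∫ p, g m n l p ∂ν := by
  have hd := dependsOn_g m n l
  have hi : ∀ j, Integrable (g m n j) ν := integrable_g m n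
  have h1 : ∫ p, (ε * g m n (l + 1) p - (4 * K * (l : ℝ) + 2 * ε) * g m n l p) ∂ν ≤ 0 := by
    rw [← hS.integral_coupledGen_eq_zero hd hν]
    refine integral_mono (((hi _).const_mul _).sub ((hi _).const_mul _))
      (integrable_of_continuous (hS.continuous_coupledGen hd) ν) fun p => ?_
    refine le_trans (le_of_eq ?_) (le_coupledGen_g_of_four_mul hc hε hcε hcK hl m n p)
    ring
  rw [integral_sub ((hi _).const_mul _) ((hi _).const_mul _), integral_const_mul,
    integral_const_mul] at h1
  linarith

theorem integral_g_one_le (hc : IsAttractiveNN c) (hε : 0 ≤ ε)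
    (hcε : ∀ (x : ℤ) (η : Config), η (x - 1) ≠ η (x + 1) → ε ≤ c x η)
    (hcK : ∀ (x : ℤ) (η ζ : Config), c x η + c x ζ ≤ K) (hS : IsCoupledSemigroup c S)
    (hν : IsInvariant S ν) (m n : ℤ) : ε * ∫ p, g m n 1 p ∂ν ≤ 2 * K := by
  have hd := dependsOn_switches m n
  have hi : Integrable (g m n 1) ν := integrable_g m n 1
  have h1 : 0 ≤ ∫ p, (2 * K - ε * g m n 1 p) ∂ν := by
    rw [← hS.integral_coupledGen_eq_zero hd hν]
    exact integral_mono (integrable_of_continuous (hS.continuous_coupledGen hd) ν)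
      ((integrable_const _).sub (hi.const_mul _))
      fun p => coupledGen_switches_le hc hε hcε hcK m n p
  rw [integral_sub (integrable_const _) (hi.const_mul _),
    integral_const_mul ε] at h1
  simp only [integral_const, probReal_univ, smul_eq_mul, one_mul] at h1
  linarith

theorem exists_integral_g_le (hc : IsAttractiveNN c) (hε : 0 < ε)
    (hcε : ∀ (x : ℤ) (η : Config), η (x - 1) ≠ η (x + 1) → ε ≤ c x η)
    (hcK : ∀ (x : ℤ) (η ζ : Config), c x η + c x ζ ≤ K) (hS : IsCoupledSemigroup c S)
    (hν : IsInvariant S ν) {l : ℕ} (hl : 1 ≤ l) :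
    ∃ C : ℝ, ∀ m n : ℤ, ∫ p, g m n l p ∂ν ≤ C := by
  induction l, hl using Nat.le_induction with
  | base =>
    refine ⟨2 * K / ε, fun m n => ?_⟩
    rw [le_div_iff₀' hε]
    exact integral_g_one_le hc hε.le hcε hcK hS hν m n
  | succ l hl ih =>
    obtain ⟨C, hC⟩ := ih
    have hK := bound_nonneg hc hcK
    refine ⟨(4 * K * (l : ℝ) + 2 * ε) * C / ε, fun m n => ?_⟩
    rw [le_div_iff₀' hε]
    exact (integral_g_succ_le hc hε.le hcε hcK hS hν hl m n).trans
      (mul_le_mul_of_nonneg_left (hC m n) (by positivity))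

end invariant

end SpinSystem

theorem mainTheorem1
    (c : ℤ → SpinSystem.Config → ℝ) (hc : SpinSystem.IsAttractiveNN c)
    (ε K : ℝ) (hε : 0 < ε)
    (hcε : ∀ (x : ℤ) (η : SpinSystem.Config), η (x - 1) ≠ η (x + 1) → ε ≤ c x η)
    (hcK : ∀ (x : ℤ) (η ζ : SpinSystem.Config), c x η + c x ζ ≤ K) :
    (∀ (l : ℕ) (m n : ℤ), 1 ≤ l → m ≤ n → ∀ p : SpinSystem.Coupled,
      ε * (SpinSystem.g m n (l + 1) p - 2 * SpinSystem.g m n l p)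
          - 4 * K * (l : ℝ) * SpinSystem.g m n l p
        ≤ SpinSystem.coupledGen c (SpinSystem.g m n l) p) ∧
    (∀ S : ℝ≥0 → C(SpinSystem.Coupled, ℝ) →ₗ[ℝ] C(SpinSystem.Coupled, ℝ),
      SpinSystem.IsCoupledSemigroup c S →
      ∀ ν : Measure SpinSystem.Coupled, IsProbabilityMeasure ν → SpinSystem.IsInvariant S ν →
        (∀ (l : ℕ) (m n : ℤ), Integrable (SpinSystem.g m n l) ν) ∧
        (∀ (l : ℕ) (m n : ℤ), 1 ≤ l → m ≤ n →
          ε * ∫ p, SpinSystem.g m n (l + 1) p ∂ν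
            ≤ (4 * K * (l : ℝ) + 2 * ε) * ∫ p, SpinSystem.g m n l p ∂ν) ∧
        (∀ l : ℕ, 1 ≤ l →
          ∃ C : ℝ, ∀ m n : ℤ, m ≤ n → ∫ p, SpinSystem.g m n l p ∂ν ≤ C)) := by
  refine ⟨fun l m n hl _ p => SpinSystem.le_coupledGen_g_of_four_mul hc hε.le hcε hcK hl m n p,
    fun S hS ν _ hν => ⟨fun l m n => SpinSystem.integrable_g m n l,
      fun l m n hl _ => SpinSystem.integral_g_succ_le hc hε.le hcε hcK hS hν hl m n,
      fun l hl => ?_⟩⟩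
  obtain ⟨C, hC⟩ := SpinSystem.exists_integral_g_le hc hε hcε hcK hS hν hl
  exact ⟨C, fun m n _ => hC m n⟩
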